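/- **Setting.** Let $\mathcal X\subset\mathbb R^d$ be a finite set of $k\ge 2$ actions that spans $\mathbb R^d$, with $\mathrm{diam}(\mathcal X)\le 1$ and $\|x\|\le L$ for all $x\in\mathcal X$. Let $\mathcal M\subset\mathbb R^d$ be a (bounded) convex polytope with $\mathrm{diam}(\mathcal M)\le 1$, and let $\theta^*\in\mathcal M$ with $\|\theta^*\|\le 1$. Assume that $x^*=\arg\max_{x\in\mathcal X}\langle x,\theta^*\rangle$ is unique and put $\Delta_{\min}=\min_{x\ne x^*}\langle x^*-x,\theta^*\rangle$. In round $t=1,2,\dots$ the learner plays $x_t\in\mathcal X$ and observes $y_t=\langle x_t,\theta^*\rangle+\epsilon_t$, where $\epsilon_t$ is $1$-subgaussian conditionally on the past and on $x_t$ (for example independent standard Gaussian). The regret is $R_n=\mathbb E\big[\max_{x\in\mathcal X}\sum_{t=1}^n\langle x-x_t,\theta^*\rangle\big]$. **Algorithm (asymptotically optimal information-directed sampling).** Start with $s=1$. The data at local time $s$ are the pairs $(x_1,y_1),\dots,(x_{s-1},y_{s-1})$ of the previous exploration rounds. Write $\|v\|_A^2=\langle v,Av\rangle$ and $H(x,z)=\{\nu\in\mathcal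 M:\langle z-x,\nu\rangle\ge 0\}$, and set - $V_s=\sum_{i<s}x_ix_i^\top+\mathbf 1_d$, $\ \hat\theta_s=V_s^{-1}\sum_{i<s}x_iy_i$, $\ \hat x_s\in\arg\max_{x\in\mathcal X}\langle x,\hat\theta_s\rangle$, $\ \beta_{s,r}^{1/2}=\sqrt{2\log r+\log\det V_s}+1$; - $\hat\Delta_s(x)=\max_{z\in\mathcal X}\big(\langle z,\hat\theta_s\rangle+\beta_{s,s^2}^{1/2}\|z\|_{V_s^{-1}}\big)-\langle x,\hat\theta_s\rangle$; - $\hat\nu_s(z)=\arg\min_{\nu\in H(\hat x_s,z)}\|\nu-\hat\theta_s\|_{V_s}^2$ for $z\ne\hat x_s$, $\ m_s=\min_{z\ne\hat x_s}\tfrac12\|\hat\nu_s(z)-\hat\theta_s\|_{V_s}^2$, $\ \eta_s=\min_{l\le s}m_l^{-1/2}\log k\in[0,\infty]$ (an action $z$ with $H(\hat x_s,z)=\emptyset$ has distance $\infty$ and weight $0$); - $q_s(z)\propto\exp\!\big(-\tfrac{\eta_s}{2}\|\hat\nu_s(z)-\hat\theta_s\|_{V_s}^2\big)$, a probability vector on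 the $z\ne\hat x_s$ (with $\infty\cdot 0=0$ and $\exp(-\infty)=0$); - $I_s(x)=\tfrac12\sum_{z\ne\hat x_s}q_s(z)\big(|\langle\hat\nu_s(z)-\hat\theta_s,x\rangle|+\beta_{s,s^2}^{1/2}\|x\|_{V_s^{-1}}\big)^2$. In round $t$: if $m_s\ge\tfrac12\beta_{s,\max(1,t\log t)}$, play $\hat x_s$ and discard the observation. Otherwise play $x_s$ drawn from a minimizer $\mu_s$ of the information ratio $\Psi_s(\mu)=\hat\Delta_s(\mu)^2/I_s(\mu)\in[0,\infty]$ over probability distributions $\mu$ on $\mathcal X$ (where $\hat\Delta_s(\mu)=\sum_x\mu(x)\hat\Delta_s(x)$ and $I_s(\mu)=\sum_x\mu(x)I_s(x)$, with $0/0=0$ and $a/0=\infty$ for $a>0$), add the pair of action and reward to the data and increase $s$ by one. Ties are broken arbitrarily (measurably in the past). **Theorem (gap-dependent regret).** For every $L$ there is a constant $C$ that depends only on $L$ (not on $d$, $\mathcal X$, $k$, $\mathcal M$, $\theta^*$, $n$) such that for all such instances and all $n\ge 2$ $$R_n\le C\,\Delta_{\min}^{-1}\,d^3\log(n)^2 .$$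 -/

import Mathlib

open MeasureTheory
open scoped ENNReal RealInnerProductSpace Matrix

noncomputable section

namespace LinBandit

/-- The feature space `ℝ^d` with its Euclidean norm. -/
abbrev Vec (d : ℕ) := EuclideanSpace ℝ (Fin d)

/-- Data collected in the exploration rounds, the most recent pair (action, reward) first.
A list of length `s - 1` holds the data `(x_1, y_1), …, (x_{s-1}, y_{s-1})` that are available
at local time `s`; its suffixes are the data at the earlier local times. -/
abbrev Data (d : ℕ) := List (Vec d × ℝ)

/-! ### Least squares -/

/-- The quadratic form `‖v‖_A² = ⟨v, A v⟩`. -/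
def quadSq {d : ℕ} (A : Matrix (Fin d) (Fin d) ℝ) (v : Vec d) : ℝ :=
  v.ofLp ⬝ᵥ (A *ᵥ v.ofLp)

/-- `V_s = ∑_{i<s} x_i x_iᵀ + 1`. -/
def gram {d : ℕ} (h : Data d) : Matrix (Fin d) (Fin d) ℝ :=
  (h.map fun p : Vec d × ℝ => Matrix.vecMulVec p.1.ofLp p.1.ofLp).sum + 1

/-- `θ̂_s = V_s⁻¹ ∑_{i<s} x_i y_i`. -/
def lsq {d : ℕ} (h : Data d) : Vec d :=
  WithLp.toLp 2 ((gram h)⁻¹ *ᵥ (h.map fun p : Vec d × ℝ => p.2 • p.1).sum.ofLp)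

/-- The local time `s` that belongs to the data. -/
def localTime {d : ℕ} (h : Data d) : ℕ := h.length + 1

/-- Square root of the confidence coefficient:
`β_{s,r}^{1/2} = √(2 log r + log det V_s) + 1`, where `r = 1/δ`. -/
def sqrtBeta {d : ℕ} (h : Data d) (r : ℝ) : ℝ :=
  √(2 * Real.log r + Real.log (gram h).det) + 1

/-- The coefficient `β_{s,s²}^{1/2}` that enters gap estimates and information gain. -/
def radius {d : ℕ} (h : Data d) : ℝ := sqrtBeta h ((localTime h : ℝ) ^ 2)

/-! ### Alternative parameters -/

/-- `H(x, z) = {ν ∈ M : ⟨z - x, ν⟩ ≥ 0}`, the parameters for which `z` is at least as good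
as `x`. -/
def halfspace {d : ℕ} (M : Set (Vec d)) (x z : Vec d) : Set (Vec d) :=
  {ν ∈ M | 0 ≤ ⟪z - x, ν⟫}

/-- A realization of the three optimization steps of the algorithm, as functions of the data:
the empirically best action `x̂_s`, the alternative parameters `ν̂_s(z)` and the sampling
distribution `μ_s`. What they have to satisfy is stated in `IsIDS`. -/
structure Choices (d : ℕ) where
  xhat : Data d → Vec d
  nu : Data d → Vec d → Vec d
  mu : Data d → Vec d → ℝ

open Classical in
/-- The actions `z ≠ x̂_s` for which an alternative parameter exists. An action `z` with
`H(x̂_s, z) = ∅` has squared distance `inf ∅ = ∞` and weight `exp(-∞) = 0`: it contributes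
nothing to minima and mixtures. -/
def alts {d : ℕ} (X : Finset (Vec d)) (M : Set (Vec d)) (c : Choices d) (h : Data d) :
    Finset (Vec d) :=
  {z ∈ X | z ≠ c.xhat h ∧ (halfspace M (c.xhat h) z).Nonempty}

/-- `‖ν̂_s(z) - θ̂_s‖²_{V_s}`. -/
def altSq {d : ℕ} (c : Choices d) (h : Data d) (z : Vec d) : ℝ :=
  quadSq (gram h) (c.nu h z - lsq h)

/-- `m_s = min_{z ≠ x̂_s} ½ ‖ν̂_s(z) - θ̂_s‖²_{V_s}` (which is `∞` if there is no alternative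
parameter at all). -/
def minAlt {d : ℕ} (X : Finset (Vec d)) (M : Set (Vec d)) (c : Choices d) (h : Data d) : ℝ≥0∞ :=
  ⨅ z ∈ alts X M c h, ENNReal.ofReal (altSq c h z / 2)

/-- The learning rate `η_s = min_{l ≤ s} m_l^{-1/2} log k`, `k = |X|`, with `0^{-1/2} = ∞`. -/
def learningRate {d : ℕ} (X : Finset (Vec d)) (M : Set (Vec d)) (c : Choices d) :
    Data d → ℝ≥0∞
  | [] => minAlt X M c [] ^ (-(1 / 2) : ℝ) * ENNReal.ofReal (Real.log X.card)
  | p :: h =>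
    min (minAlt X M c (p :: h) ^ (-(1 / 2) : ℝ) * ENNReal.ofReal (Real.log X.card))
      (learningRate X M c h)

open Classical in
/-- `exp(-(η/2) a)` for `η ∈ [0, ∞]` and `a ≥ 0`, with `∞ · 0 = 0` and `exp(-∞) = 0`. -/
def expWeight (η : ℝ≥0∞) (a : ℝ) : ℝ :=
  if η = ⊤ then (if a = 0 then 1 else 0) else Real.exp (-(η.toReal / 2 * a))

/-- The normalized mixing weights `q_s(z) ∝ exp(-(η_s/2) ‖ν̂_s(z) - θ̂_s‖²_{V_s})` on the
alternatives `z ≠ x̂_s`. -/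
def mixWeight {d : ℕ} (X : Finset (Vec d)) (M : Set (Vec d)) (c : Choices d) (h : Data d)
    (z : Vec d) : ℝ :=
  expWeight (learningRate X M c h) (altSq c h z) /
    ∑ w ∈ alts X M c h, expWeight (learningRate X M c h) (altSq c h w)

/-! ### Gap estimate, information gain and information ratio -/

/-- `Δ̂_s(x) = max_{z ∈ X} (⟨z, θ̂_s⟩ + β_{s,s²}^{1/2} ‖z‖_{V_s⁻¹}) - ⟨x, θ̂_s⟩`. -/
def gapEst {d : ℕ} (X : Finset (Vec d)) (h : Data d) (x : Vec d) : ℝ :=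
  (⨆ z : X, (⟪z.1, lsq h⟫ + radius h * √(quadSq (gram h)⁻¹ z.1))) - ⟪x, lsq h⟫

/-- `I_s(x) = ½ ∑_{z ≠ x̂_s} q_s(z) (|⟨ν̂_s(z) - θ̂_s, x⟩| + β_{s,s²}^{1/2} ‖x‖_{V_s⁻¹})²`. -/
def infoGain {d : ℕ} (X : Finset (Vec d)) (M : Set (Vec d)) (c : Choices d) (h : Data d)
    (x : Vec d) : ℝ :=
  (1 / 2) * ∑ z ∈ alts X M c h, mixWeight X M c h z *
    (|⟪c.nu h z - lsq h, x⟫| + radius h * √(quadSq (gram h)⁻¹ x)) ^ 2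

/-- Probability vectors on the finite action set. -/
def IsDistr {d : ℕ} (X : Finset (Vec d)) (μ : Vec d → ℝ) : Prop :=
  (∀ x ∈ X, 0 ≤ μ x) ∧ ∑ x ∈ X, μ x = 1

/-- The information ratio `Ψ_s(μ) = Δ̂_s(μ)² / I_s(μ)` with values in `[0, ∞]`; in `[0, ∞]`
one has `a / 0 = ∞` for `a > 0` and `0 / 0 = 0`. -/
def infoRatio {d : ℕ} (X : Finset (Vec d)) (M : Set (Vec d)) (c : Choices d) (h : Data d)
    (μ : Vec d → ℝ) : ℝ≥0∞ :=
  ENNReal.ofReal ((∑ x ∈ X, μ x * gapEst X h x) ^ 2) /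
    ENNReal.ofReal (∑ x ∈ X, μ x * infoGain X M c h x)

/-- The choices solve the optimization problems of the algorithm (ties are broken arbitrarily):
`x̂_s = argmax_{x ∈ X} ⟨x, θ̂_s⟩`, `ν̂_s(z) = argmin_{ν ∈ H(x̂_s, z)} ‖ν - θ̂_s‖²_{V_s}` and
`μ_s = argmin_μ Ψ_s(μ)`. -/
structure IsIDS {d : ℕ} (X : Finset (Vec d)) (M : Set (Vec d)) (c : Choices d) : Prop where
  xhat_mem : ∀ h, c.xhat h ∈ X
  xhat_max : ∀ h, ∀ x ∈ X, ⟪x, lsq h⟫ ≤ ⟪c.xhat h, lsq h⟫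
  nu_mem : ∀ h, ∀ z ∈ alts X M c h, c.nu h z ∈ halfspace M (c.xhat h) z
  nu_min : ∀ h, ∀ z ∈ alts X M c h, ∀ ν ∈ halfspace M (c.xhat h) z,
    altSq c h z ≤ quadSq (gram h) (ν - lsq h)
  mu_distr : ∀ h, IsDistr X (c.mu h)
  mu_min : ∀ h, ∀ μ, IsDistr X μ → infoRatio X M c h (c.mu h) ≤ infoRatio X M c h μ

/-! ### Interaction with the environment -/

/-- The exploitation condition `m_s ≥ ½ β_{s, t log t}` in global round `t`. (In round `t = 1`,
where `t log t = 0`, the value `1` is used instead; `t log t > 1` for `t ≥ 2`.) -/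
def Exploit {d : ℕ} (X : Finset (Vec d)) (M : Set (Vec d)) (c : Choices d) (h : Data d)
    (t : ℕ) : Prop :=
  ENNReal.ofReal (sqrtBeta h (max 1 (t * Real.log t)) ^ 2 / 2) ≤ minAlt X M c h

open Classical in
/-- Probability with which action `a` is played in global round `t`, given the data:
`x̂_s` is played in an exploitation round, and `x_s ∼ μ_s` in an exploration round. -/
def actionProb {d : ℕ} (X : Finset (Vec d)) (M : Set (Vec d)) (c : Choices d) (h : Data d)
    (t : ℕ) (a : Vec d) : ℝ :=
  if Exploit X M c h t then (if a = c.xhat h then 1 else 0) else c.mu h a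

open Classical in
/-- Data available after `t` global rounds, along the sequences of actions `x_1, x_2, …` and
noise variables `ε_1, ε_2, …`: exploration rounds add the pair `(x_t, ⟨x_t, θ⟩ + ε_t)`,
the reward of an exploitation round is disregarded. -/
def dataAt {d : ℕ} (X : Finset (Vec d)) (M : Set (Vec d)) (c : Choices d) (θ : Vec d)
    (x : ℕ → Vec d) (ε : ℕ → ℝ) : ℕ → Data d
  | 0 => []
  | t + 1 =>
    if Exploit X M c (dataAt X M c θ x ε t) (t + 1) then dataAt X M c θ x ε t
    else (x (t + 1), ⟪x (t + 1), θ⟫ + ε (t + 1)) :: dataAt X M c θ x ε t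

/-- The process of actions `x_t` and noise `ε_t`, `t = 1, 2, …`, on a probability space with
a filtration `ℱ` (`ℱ t` is the information after `t` rounds) is generated by the algorithm
run on the linear bandit with parameter `θ` and conditionally 1-subgaussian noise. -/
structure IsRun {d : ℕ} {Ω : Type*} {mΩ : MeasurableSpace Ω} (P : Measure Ω)
    (ℱ : Filtration ℕ mΩ) (X : Finset (Vec d)) (M : Set (Vec d)) (c : Choices d) (θ : Vec d)
    (x : ℕ → Ω → Vec d) (ε : ℕ → Ω → ℝ) : Prop where
  action_mem : ∀ t ω, x (t + 1) ω ∈ X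
  action_meas : ∀ t, Measurable[ℱ (t + 1)] (x (t + 1))
  noise_meas : ∀ t, Measurable[ℱ (t + 1)] (ε (t + 1))
  /-- The decisions of the learner depend measurably on the past. -/
  exploit_meas : ∀ t, MeasurableSet[ℱ t]
    {ω | Exploit X M c (dataAt X M c θ (fun i => x i ω) (fun i => ε i ω) t) (t + 1)}
  xhat_meas : ∀ t, Measurable[ℱ t]
    fun ω => c.xhat (dataAt X M c θ (fun i => x i ω) (fun i => ε i ω) t)
  nu_meas : ∀ t, ∀ z ∈ X, Measurable[ℱ t]
    fun ω => c.nu (dataAt X M c θ (fun i => x i ω) (fun i => ε i ω) t) z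
  mu_meas : ∀ t, ∀ a ∈ X, Measurable[ℱ t]
    fun ω => c.mu (dataAt X M c θ (fun i => x i ω) (fun i => ε i ω) t) a
  /-- Conditional law of the action in round `t + 1`, given the past. -/
  action_law : ∀ t, ∀ a ∈ X,
    P[(x (t + 1) ⁻¹' {a}).indicator (fun _ => (1 : ℝ)) | ℱ t] =ᵐ[P]
      fun ω => actionProb X M c (dataAt X M c θ (fun i => x i ω) (fun i => ε i ω) t) (t + 1) a
  /-- The noise is 1-subgaussian, conditionally on the past and the chosen action. -/
  noise_integrable : ∀ t (r : ℝ), Integrable (fun ω => Real.exp (r * ε (t + 1) ω)) P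
  noise_subgaussian : ∀ t (r : ℝ),
    P[fun ω => Real.exp (r * ε (t + 1) ω) |
        ℱ t ⊔ MeasurableSpace.comap (x (t + 1)) inferInstance] ≤ᵐ[P]
      fun _ => Real.exp (r ^ 2 / 2)

/-- The expected regret `R_n = 𝔼[max_{a ∈ X} ∑_{t=1}^n ⟨a - x_t, θ⟩]`. -/
def regret {d : ℕ} {Ω : Type*} {mΩ : MeasurableSpace Ω} (P : Measure Ω)
    (X : Finset (Vec d)) (θ : Vec d) (x : ℕ → Ω → Vec d) (n : ℕ) : ℝ :=
  ∫ ω, ⨆ a : X, ∑ t ∈ Finset.Icc 1 n, ⟪a.1 - x t ω, θ⟫ ∂P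

open Classical in
/-- The smallest gap `Δ_min = min_{a ≠ x*} ⟨x* - a, θ⟩`. -/
def minGap {d : ℕ} (X : Finset (Vec d)) (θ xstar : Vec d)
    (hX : ∃ a ∈ X, a ≠ xstar) : ℝ :=
  ({a ∈ X | a ≠ xstar}).inf' (Finset.filter_nonempty_iff.mpr hX) fun a => ⟪xstar - a, θ⟫

end LinBandit

end

/-! The maximum in the regret is attained at `xstar` on every path, so the regret is the expected
sum of the gaps `⟨x* - x_t, θ⟩ ∈ [0, 1]`. Rounds are of three kinds: exploitation, exploration with
a confidence ellipsoid that misses `θ`, and exploration on the confidence event.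

The first two kinds cost `O(log n)`. With `S = ∑ x_i ε_i`, the mixture process `evidence =
exp(½‖S‖²_{V⁻¹}) / √(det V)` starts at `1` and its mean never increases
(`lintegral_evidence_collect_le`), while `‖θ̂ - θ‖_V ≥ β_{s,r}^{1/2}` forces it to be at least `r`
(`le_evidence`). If some `x̂ ≠ x*` is exploited, `θ` itself is an alternative parameter, so the
evidence is at least `t log t`. Misses are counted by the number `k` of observations, on data frozen
at `k`.

The third kind carries the rate. Let `D`, `I` be the mean gap estimate and information gain of
`μ_s`, and `δ` the gap estimate of `x̂`. The key is `Δ_min D ≤ 64 d I` (`minGap_mul_meanGap_le`),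
linear in `I`. As `μ_s` minimizes the ratio, it can be compared with two distributions. The
optimistic action gives `D² ≤ 2I`, enough when `δ` is of order `Δ_min` or larger. Otherwise `x̂ =
x*`, and `G = ∑ q(z)⟨x̂ - z, θ̂⟩ ≥ Δ_min / 4`; the mixture `(1 - δ/G) x̂ + (δ/G) q` has gap estimate
`2δ` and information at least `δG/(4d)`, whence `G D ≤ 16 d I`. That information bound is a
decoupling by a trace inequality (`sq_sum_inner_le`), the source of one factor `d`.

Finally `I` is at most `O(d log n)` times the `μ_s`-mean of `‖x‖²_{V⁻¹}`, because exponential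
weights concentrate near the minimum and `log k` cancels against `η_s` (`sum_mixWeight_altSq_le`).
The elliptical potential sums `‖x‖²_{V⁻¹}` to `O(d log n)`. Altogether `d · d log n · d log n`. -/

noncomputable section

namespace LinBandit

/-! ### Quadratic forms -/

section Quadratic

variable {d : ℕ}

lemma inner_eq_dotProduct (x y : Vec d) : ⟪x, y⟫ = x.ofLp ⬝ᵥ y.ofLp := by
  rw [EuclideanSpace.inner_eq_star_dotProduct, star_trivial, dotProduct_comm]

lemma norm_sq_eq_dotProduct (x : Vec d) : ‖x‖ ^ 2 = x.ofLp ⬝ᵥ x.ofLp := by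
  rw [← inner_eq_dotProduct, real_inner_self_eq_norm_sq]

lemma quadSq_nonneg {A : Matrix (Fin d) (Fin d) ℝ} (hA : A.PosSemidef) (v : Vec d) :
    0 ≤ quadSq A v := by
  simpa [quadSq] using hA.dotProduct_mulVec_nonneg v.ofLp

lemma dotProduct_mulVec_symm {A : Matrix (Fin d) (Fin d) ℝ} (hA : A.IsHermitian)
    (v w : Fin d → ℝ) : v ⬝ᵥ (A *ᵥ w) = w ⬝ᵥ (A *ᵥ v) := by
  have h : Aᵀ = A := by simpa [Matrix.IsHermitian] using hA
  rw [Matrix.dotProduct_mulVec, ← Matrix.mulVec_transpose, h, dotProduct_comm]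

lemma mulVec_inv_mulVec {A : Matrix (Fin d) (Fin d) ℝ} (hA : A.PosDef) (v : Fin d → ℝ) :
    A *ᵥ (A⁻¹ *ᵥ v) = v := by
  rw [Matrix.mulVec_mulVec, Matrix.mul_nonsing_inv _ ((Matrix.isUnit_iff_isUnit_det A).mp hA.isUnit),
    Matrix.one_mulVec]

lemma inv_mulVec_mulVec {A : Matrix (Fin d) (Fin d) ℝ} (hA : A.PosDef) (v : Fin d → ℝ) :
    A⁻¹ *ᵥ (A *ᵥ v) = v := by
  rw [Matrix.mulVec_mulVec, Matrix.nonsing_inv_mul _ ((Matrix.isUnit_iff_isUnit_det A).mp hA.isUnit),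
    Matrix.one_mulVec]

lemma quadSq_smul (A : Matrix (Fin d) (Fin d) ℝ) (r : ℝ) (v : Vec d) :
    quadSq A (r • v) = r ^ 2 * quadSq A v := by
  simp [quadSq, Matrix.mulVec_smul, smul_dotProduct, dotProduct_smul]; ring

/-- Cauchy–Schwarz inequality for a positive definite form and its dual. -/
lemma inner_sq_le_quadSq_mul {A : Matrix (Fin d) (Fin d) ℝ} (hA : A.PosDef) (w x : Vec d) :
    ⟪w, x⟫ ^ 2 ≤ quadSq A w * quadSq A⁻¹ x := by
  set y : Fin d → ℝ := A⁻¹ *ᵥ x.ofLp with hy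
  have hx : x.ofLp = A *ᵥ y := (mulVec_inv_mulVec hA _).symm
  have hq : quadSq A⁻¹ x = y ⬝ᵥ (A *ᵥ y) := by
    rw [quadSq, ← hy, hx, dotProduct_comm]
  have key : ∀ t : ℝ, 0 ≤ quadSq A⁻¹ x * (t * t) + (2 * ⟪w, x⟫) * t + quadSq A w := by
    intro t
    have h := hA.posSemidef.dotProduct_mulVec_nonneg (w.ofLp + t • y)
    have e : star (w.ofLp + t • y) ⬝ᵥ (A *ᵥ (w.ofLp + t • y))
        = quadSq A⁻¹ x * (t * t) + (2 * ⟪w, x⟫) * t + quadSq A w := by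
      rw [hq, inner_eq_dotProduct, hx, quadSq, star_trivial, Matrix.mulVec_add, Matrix.mulVec_smul,
        add_dotProduct, dotProduct_add, dotProduct_add, smul_dotProduct, smul_dotProduct,
        dotProduct_smul, dotProduct_smul, dotProduct_mulVec_symm hA.isHermitian y w.ofLp]
      simp only [smul_eq_mul]; ring
    rw [← e]; exact h
  have := discrim_le_zero key
  rw [discrim] at this
  nlinarith

lemma abs_inner_le_quadSq {A : Matrix (Fin d) (Fin d) ℝ} (hA : A.PosDef) (w x : Vec d) :
    |⟪w, x⟫| ≤ √(quadSq A w) * √(quadSq A⁻¹ x) := by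
  rw [← Real.sqrt_mul (quadSq_nonneg hA.posSemidef w), ← Real.sqrt_sq_eq_abs]
  exact Real.sqrt_le_sqrt (inner_sq_le_quadSq_mul hA w x)

/-- Rank-one update of the determinant. -/
lemma det_add_vecMulVec_self {A : Matrix (Fin d) (Fin d) ℝ} (hA : A.PosDef) (x : Vec d) :
    (A + Matrix.vecMulVec x.ofLp x.ofLp).det = A.det * (1 + quadSq A⁻¹ x) := by
  rw [Matrix.vecMulVec_eq Unit,
    Matrix.det_add_replicateCol_mul_replicateRow ((Matrix.isUnit_iff_isUnit_det A).mp hA.isUnit)]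
  congr 2
  rw [quadSq, Matrix.mul_assoc, ← Matrix.replicateCol_mulVec]
  simp [Matrix.det_unique, Matrix.mul_apply, dotProduct]

lemma add_vecMulVec_self_posDef {A : Matrix (Fin d) (Fin d) ℝ} (hA : A.PosDef) (x : Fin d → ℝ) :
    (A + Matrix.vecMulVec x x).PosDef :=
  hA.add_posSemidef (by simpa using Matrix.posSemidef_vecMulVec_self_star x)

/-- Rank-one update of the inverse quadratic form. -/
lemma quadSq_inv_add_vecMulVec_self {A : Matrix (Fin d) (Fin d) ℝ} (hA : A.PosDef)
    (S x : Vec d) (e : ℝ) :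
    quadSq (A + Matrix.vecMulVec x.ofLp x.ofLp)⁻¹ (S + e • x)
      = quadSq A⁻¹ S + (2 * (x.ofLp ⬝ᵥ (A⁻¹ *ᵥ S.ofLp)) * e + quadSq A⁻¹ x * e ^ 2
          - (x.ofLp ⬝ᵥ (A⁻¹ *ᵥ S.ofLp)) ^ 2) / (1 + quadSq A⁻¹ x) := by
  set b := x.ofLp ⬝ᵥ (A⁻¹ *ᵥ S.ofLp) with hb
  set u := quadSq A⁻¹ x with hu
  have hu0 : 0 ≤ u := quadSq_nonneg hA.inv.posSemidef x
  set B := A + Matrix.vecMulVec x.ofLp x.ofLp with hB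
  -- Sherman–Morrison in solved form: `B⁻¹ (S + e x) = A⁻¹ S + cc A⁻¹ x`, which is checked by
  -- applying `B`.
  set cc := (e - b) / (1 + u) with hc
  have hBp : B.PosDef := add_vecMulVec_self_posDef hA _
  have hw : B *ᵥ (A⁻¹ *ᵥ S.ofLp + cc • (A⁻¹ *ᵥ x.ofLp)) = (S + e • x).ofLp := by
    rw [hB, Matrix.add_mulVec, Matrix.mulVec_add, Matrix.mulVec_smul, mulVec_inv_mulVec hA,
      mulVec_inv_mulVec hA, Matrix.vecMulVec_mulVec, dotProduct_add, dotProduct_smul, ← hb]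
    change S.ofLp + cc • x.ofLp + MulOpposite.op (b + cc • u) • x.ofLp = S.ofLp + e • x.ofLp
    rw [op_smul_eq_smul, add_assoc, ← add_smul]
    congr 2
    rw [hc, smul_eq_mul]; field_simp; ring
  have hsym : S.ofLp ⬝ᵥ (A⁻¹ *ᵥ x.ofLp) = b := dotProduct_mulVec_symm hA.inv.isHermitian _ _
  rw [quadSq, ← hw, inv_mulVec_mulVec hBp, hw]
  change (S.ofLp + e • x.ofLp) ⬝ᵥ _ = _
  rw [add_dotProduct, dotProduct_add, dotProduct_add, dotProduct_smul, dotProduct_smul,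
    smul_dotProduct, smul_dotProduct, hsym, ← hb]
  change quadSq A⁻¹ S + cc * b + (e * b + cc * (e * u)) = _
  rw [hc]; field_simp; ring

end Quadratic

/-! ### The Gram matrix and the least squares estimate -/

section Gram

variable {d : ℕ}

lemma gram_nil : gram ([] : Data d) = 1 := by simp [gram]

lemma gram_cons (p : Vec d × ℝ) (h : Data d) :
    gram (p :: h) = gram h + Matrix.vecMulVec p.1.ofLp p.1.ofLp := by
  simp only [gram, List.map_cons, List.sum_cons]; abel

lemma gram_posDef (h : Data d) : (gram h).PosDef := by
  induction h with
  | nil => rw [gram_nil]; exact Matrix.PosDef.one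
  | cons p h ih => rw [gram_cons]; exact add_vecMulVec_self_posDef ih _

lemma gram_inv_nonneg (h : Data d) (v : Vec d) : 0 ≤ quadSq (gram h)⁻¹ v :=
  quadSq_nonneg (gram_posDef h).inv.posSemidef v

lemma gram_nonneg (h : Data d) (v : Vec d) : 0 ≤ quadSq (gram h) v :=
  quadSq_nonneg (gram_posDef h).posSemidef v

lemma quadSq_gram_cons (p : Vec d × ℝ) (h : Data d) (v : Vec d) :
    quadSq (gram (p :: h)) v = quadSq (gram h) v + ⟪p.1, v⟫ ^ 2 := by
  rw [gram_cons, quadSq, quadSq, Matrix.add_mulVec, dotProduct_add, Matrix.vecMulVec_mulVec,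
    op_smul_eq_smul, dotProduct_smul, inner_eq_dotProduct, dotProduct_comm v.ofLp p.1.ofLp,
    smul_eq_mul, sq]

lemma norm_sq_le_quadSq_gram (h : Data d) (v : Vec d) : ‖v‖ ^ 2 ≤ quadSq (gram h) v := by
  induction h with
  | nil => rw [gram_nil, norm_sq_eq_dotProduct, quadSq, Matrix.one_mulVec]
  | cons p h ih => rw [quadSq_gram_cons]; nlinarith [sq_nonneg ⟪p.1, v⟫]

lemma quadSq_gram_le {L : ℝ} (h : Data d) (hL : ∀ p ∈ h, ‖p.1‖ ≤ L) (v : Vec d) :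
    quadSq (gram h) v ≤ (1 + h.length * L ^ 2) * ‖v‖ ^ 2 := by
  induction h with
  | nil => rw [gram_nil, norm_sq_eq_dotProduct, quadSq, Matrix.one_mulVec]; simp
  | cons p h ih =>
    have h1 := ih fun q hq => hL q (List.mem_cons_of_mem _ hq)
    have h2 : ‖p.1‖ ≤ L := hL p List.mem_cons_self
    have h3 : ⟪p.1, v⟫ ^ 2 ≤ (‖p.1‖ * ‖v‖) ^ 2 := by
      rw [← sq_abs]; exact pow_le_pow_left₀ (abs_nonneg _) (abs_real_inner_le_norm _ _) 2
    have h4 : (‖p.1‖ * ‖v‖) ^ 2 ≤ (L * ‖v‖) ^ 2 := by gcongr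
    rw [quadSq_gram_cons, List.length_cons]; push_cast
    nlinarith

/-- Because `V ≥ 1`: for `y = V⁻¹ v` one has `‖y‖² ≤ ‖y‖²_V = ⟨v, y⟩ ≤ ½(‖v‖² + ‖y‖²)`. -/
lemma quadSq_gram_inv_le (h : Data d) (v : Vec d) : quadSq (gram h)⁻¹ v ≤ ‖v‖ ^ 2 := by
  set V := gram h
  have hV : V.PosDef := gram_posDef h
  set y : Vec d := WithLp.toLp 2 (V⁻¹ *ᵥ v.ofLp) with hy
  have hq : quadSq V⁻¹ v = quadSq V y := by
    rw [quadSq, quadSq, hy, WithLp.ofLp_toLp, mulVec_inv_mulVec hV, dotProduct_comm]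
  have hi : quadSq V⁻¹ v = ⟪v, y⟫ := by rw [inner_eq_dotProduct, quadSq]
  have h1 : ‖y‖ ^ 2 ≤ quadSq V⁻¹ v := hq ▸ norm_sq_le_quadSq_gram h y
  have h2 : quadSq V⁻¹ v ≤ ‖v‖ * ‖y‖ := hi ▸ real_inner_le_norm _ _
  nlinarith [sq_nonneg (‖v‖ - ‖y‖), norm_nonneg v, norm_nonneg y]

lemma det_gram_cons (p : Vec d × ℝ) (h : Data d) :
    (gram (p :: h)).det = (gram h).det * (1 + quadSq (gram h)⁻¹ p.1) := by
  rw [gram_cons, det_add_vecMulVec_self (gram_posDef h)]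

lemma one_le_det_gram (h : Data d) : 1 ≤ (gram h).det := by
  induction h with
  | nil => simp [gram_nil]
  | cons p h ih =>
    rw [det_gram_cons]; nlinarith [gram_inv_nonneg h p.1]

lemma det_gram_le {L : ℝ} (h : Data d) (hL : ∀ p ∈ h, ‖p.1‖ ≤ L) :
    (gram h).det ≤ (1 + h.length * L ^ 2) ^ d := by
  have hV := (gram_posDef h).isHermitian
  rw [hV.det_eq_prod_eigenvalues]
  have : ∀ i, (hV.eigenvalues i : ℝ) ≤ 1 + h.length * L ^ 2 := by
    intro i
    have h1 := quadSq_gram_le h hL (hV.eigenvectorBasis i)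
    have h2 := hV.eigenvalues_eq i
    simp only [hV.eigenvectorBasis.norm_eq_one, one_pow, mul_one] at h1
    rw [h2]; simpa [quadSq] using h1
  calc ∏ i, (hV.eigenvalues i : ℝ) ≤ ∏ _i : Fin d, (1 + h.length * L ^ 2) :=
        Finset.prod_le_prod (fun i _ => ((gram_posDef h).eigenvalues_pos i).le) fun i _ => this i
    _ = _ := by simp

/-- The noise part `∑ x_i (y_i - ⟨x_i, θ⟩)` of the data. -/
def noiseSum (θ : Vec d) (h : Data d) : Vec d :=
  (h.map fun p : Vec d × ℝ => (p.2 - ⟪p.1, θ⟫) • p.1).sum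

lemma noiseSum_nil (θ : Vec d) : noiseSum θ [] = 0 := by simp [noiseSum]

lemma noiseSum_cons (θ : Vec d) (p : Vec d × ℝ) (h : Data d) :
    noiseSum θ (p :: h) = noiseSum θ h + (p.2 - ⟪p.1, θ⟫) • p.1 := by
  simp only [noiseSum, List.map_cons, List.sum_cons]; abel

lemma gram_mulVec_eq (θ : Vec d) (h : Data d) :
    gram h *ᵥ θ.ofLp
      = (h.map fun p : Vec d × ℝ => p.2 • p.1).sum.ofLp - (noiseSum θ h).ofLp + θ.ofLp := by
  induction h with
  | nil => simp [gram_nil, noiseSum_nil]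
  | cons p h ih =>
    rw [gram_cons, Matrix.add_mulVec, ih, noiseSum_cons, Matrix.vecMulVec_mulVec, op_smul_eq_smul,
      List.map_cons, List.sum_cons, inner_eq_dotProduct]
    ext i
    simp; ring

/-- Normal equations. The term `-θ` is the bias of the regularizer; as `‖θ‖_{V⁻¹} ≤ 1`, it accounts
for the summand `1` in `sqrtBeta`. -/
lemma gram_mulVec_lsq_sub (θ : Vec d) (h : Data d) :
    gram h *ᵥ (lsq h - θ).ofLp = (noiseSum θ h - θ).ofLp := by
  rw [WithLp.ofLp_sub, WithLp.ofLp_sub, Matrix.mulVec_sub, gram_mulVec_eq θ h, lsq, WithLp.ofLp_toLp,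
    mulVec_inv_mulVec (gram_posDef h)]
  abel

/-- The estimation error is controlled by the noise. -/
lemma sqrt_quadSq_lsq_sub_le {θ : Vec d} (hθ : ‖θ‖ ≤ 1) (h : Data d) :
    √(quadSq (gram h) (lsq h - θ)) ≤ √(quadSq (gram h)⁻¹ (noiseSum θ h)) + 1 := by
  have hV := gram_posDef h
  set q := quadSq (gram h) (lsq h - θ) with hq
  have h0 : 0 ≤ q := gram_nonneg h _
  have e : q = ⟪lsq h - θ, noiseSum θ h⟫ - ⟪lsq h - θ, θ⟫ := by
    rw [← inner_sub_right, inner_eq_dotProduct, ← gram_mulVec_lsq_sub, hq, quadSq]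
  have h1 := (le_abs_self _).trans (abs_inner_le_quadSq hV (lsq h - θ) (noiseSum θ h))
  have h2 := (neg_le_abs _).trans (abs_inner_le_quadSq hV (lsq h - θ) θ)
  have h3 : √(quadSq (gram h)⁻¹ θ) ≤ 1 := by
    rw [Real.sqrt_le_one]
    exact (quadSq_gram_inv_le h θ).trans (by nlinarith [norm_nonneg θ])
  rw [← hq] at h1 h2
  have h4 : √q * √q = q := Real.mul_self_sqrt h0
  rcases (Real.sqrt_nonneg q).eq_or_lt with h5 | h5
  · rw [← h5]; positivity
  · have : √q * √q ≤ √q * (√(quadSq (gram h)⁻¹ (noiseSum θ h)) + 1) := by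
      nlinarith [mul_le_mul_of_nonneg_left h3 h5.le]
    exact le_of_mul_le_mul_left this h5

end Gram

/-! ### Decoupling -/

section Decoupling

variable {d : ℕ} {ι : Type*}

/-- Trace inequality: the diagonal mean of a bilinear form of rank at most `d` is controlled by
its mean square. -/
lemma sq_sum_inner_le (s : Finset ι) (q : ι → ℝ) (hq : ∀ i ∈ s, 0 ≤ q i) (w x : ι → Vec d) :
    (∑ i ∈ s, q i * ⟪w i, x i⟫) ^ 2
      ≤ d * ∑ j ∈ s, q j * ∑ i ∈ s, q i * ⟪w i, x j⟫ ^ 2 := by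
  -- The second moment of `x` under `q`. Working in its eigenbasis avoids `T^{-1/2}`, so `T` may be
  -- singular.
  let T : Vec d →ₗ[ℝ] Vec d :=
    ∑ j ∈ s, q j • (((innerSL ℝ (x j)).smulRight (x j) : Vec d →L[ℝ] Vec d) : Vec d →ₗ[ℝ] Vec d)
  have hT : ∀ v, T v = ∑ j ∈ s, q j • (⟪x j, v⟫ • x j) := by
    intro v; simp [T, LinearMap.sum_apply]
  have hTi : ∀ v u, ⟪T v, u⟫ = ∑ j ∈ s, q j * (⟪x j, v⟫ * ⟪x j, u⟫) := by
    intro v u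
    rw [hT, sum_inner]
    exact Finset.sum_congr rfl fun j _ => by
      rw [real_inner_smul_left, real_inner_smul_left]
  have hsymm : T.IsSymmetric := by
    intro v u
    rw [hTi, real_inner_comm, hTi]
    exact Finset.sum_congr rfl fun j _ => by ring
  have hn : Module.finrank ℝ (Vec d) = d := by simp
  let e := hsymm.eigenvectorBasis hn
  let l := hsymm.eigenvalues hn
  have hl : ∀ i, T (e i) = l i • e i := fun i =>
    hsymm.apply_eigenvectorBasis hn i
  have hle : ∀ i, ∑ j ∈ s, q j * ⟪x j, e i⟫ ^ 2 = l i := by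
    intro i
    have h := hTi (e i) (e i)
    rw [hl, real_inner_smul_left, real_inner_self_eq_norm_sq, e.norm_eq_one] at h
    simp only [one_pow, mul_one] at h
    rw [h]; exact Finset.sum_congr rfl fun j _ => by ring
  have hsq : ∀ v, ∑ j ∈ s, q j * ⟪v, x j⟫ ^ 2 = ∑ i, l i * ⟪v, e i⟫ ^ 2 := by
    intro v
    have h1 : ∑ j ∈ s, q j * ⟪v, x j⟫ ^ 2 = ⟪T v, v⟫ := by
      rw [hTi]; exact Finset.sum_congr rfl fun j _ => by rw [real_inner_comm]; ring
    rw [h1, ← e.sum_inner_mul_inner (T v) v]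
    refine Finset.sum_congr rfl fun i _ => ?_
    rw [hsymm, hl, real_inner_smul_right, real_inner_comm v (e i)]; ring
  have hrhs : ∑ j ∈ s, q j * ∑ i ∈ s, q i * ⟪w i, x j⟫ ^ 2
      = ∑ k, l k * ∑ i ∈ s, q i * ⟪w i, e k⟫ ^ 2 := by
    calc ∑ j ∈ s, q j * ∑ i ∈ s, q i * ⟪w i, x j⟫ ^ 2
        = ∑ i ∈ s, q i * ∑ j ∈ s, q j * ⟪w i, x j⟫ ^ 2 := by
          simp only [Finset.mul_sum]; rw [Finset.sum_comm]
          exact Finset.sum_congr rfl fun _ _ => Finset.sum_congr rfl fun _ _ => by ring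
      _ = ∑ i ∈ s, q i * ∑ k, l k * ⟪w i, e k⟫ ^ 2 := by simp only [hsq]
      _ = _ := by
          simp only [Finset.mul_sum]; rw [Finset.sum_comm]
          exact Finset.sum_congr rfl fun _ _ => Finset.sum_congr rfl fun _ _ => by ring
  have hlhs : ∑ i ∈ s, q i * ⟪w i, x i⟫ = ∑ k, ∑ i ∈ s, q i * (⟪w i, e k⟫ * ⟪x i, e k⟫) := by
    rw [Finset.sum_comm]
    refine Finset.sum_congr rfl fun i _ => ?_
    rw [← e.sum_inner_mul_inner (w i) (x i), Finset.mul_sum]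
    exact Finset.sum_congr rfl fun k _ => by rw [real_inner_comm (x i) (e k)]
  rw [hlhs, hrhs]
  -- Cauchy–Schwarz twice: over the `d` coordinates, which costs the factor `d`, and over `s` with
  -- weights `q`, where `∑ q ⟨x, e_k⟩²` is the eigenvalue `l k`.
  calc (∑ k, ∑ i ∈ s, q i * (⟪w i, e k⟫ * ⟪x i, e k⟫)) ^ 2
      ≤ (Finset.univ : Finset (Fin d)).card
          * ∑ k, (∑ i ∈ s, q i * (⟪w i, e k⟫ * ⟪x i, e k⟫)) ^ 2 := sq_sum_le_card_mul_sum_sq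
    _ = d * ∑ k, (∑ i ∈ s, q i * (⟪w i, e k⟫ * ⟪x i, e k⟫)) ^ 2 := by simp
    _ ≤ _ := by
        refine mul_le_mul_of_nonneg_left (Finset.sum_le_sum fun k _ => ?_) (Nat.cast_nonneg d)
        rw [← hle k, mul_comm]
        refine Finset.sum_sq_le_sum_mul_sum_of_sq_le_mul s
          (fun i hi => mul_nonneg (hq i hi) (sq_nonneg _))
          (fun i hi => mul_nonneg (hq i hi) (sq_nonneg _)) fun i hi => le_of_eq (by ring)

/-- Jensen's inequality for the square. -/
lemma sq_sum_mul_le (s : Finset ι) (q f : ι → ℝ) (hq : ∀ i ∈ s, 0 ≤ q i)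
    (hq1 : ∑ i ∈ s, q i = 1) : (∑ i ∈ s, q i * f i) ^ 2 ≤ ∑ i ∈ s, q i * f i ^ 2 := by
  have := Finset.sum_sq_le_sum_mul_sum_of_sq_le_mul s (r := fun i => q i * f i) (f := q)
    (g := fun i => q i * f i ^ 2) hq (fun i hi => mul_nonneg (hq i hi) (sq_nonneg _))
    fun i hi => le_of_eq (by ring)
  rwa [hq1, one_mul] at this

/-- Exponential weights concentrate near the minimum. -/
lemma sum_exp_weights_le (s : Finset ι) (v : ι → ℝ) {i₀ : ι} (hi₀ : i₀ ∈ s) :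
    ∑ i ∈ s, Real.exp (-v i) / (∑ j ∈ s, Real.exp (-v j)) * v i ≤ v i₀ + Real.log s.card := by
  set Z := ∑ j ∈ s, Real.exp (-v j) with hZ
  have hZ0 : Real.exp (-v i₀) ≤ Z :=
    Finset.single_le_sum (f := fun j => Real.exp (-v j)) (fun j _ => (Real.exp_pos _).le) hi₀
  have hZp : 0 < Z := (Real.exp_pos _).trans_le hZ0
  have hc : (0 : ℝ) < s.card := by exact_mod_cast Finset.card_pos.mpr ⟨i₀, hi₀⟩
  -- Jensen for `exp`: under weights proportional to `exp (-v)` the mean of `exp v` is exactly `card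
  -- / Z`.
  have hJ := convexOn_exp.map_sum_le (t := s) (w := fun i => Real.exp (-v i) / Z) (p := v)
    (fun i _ => by positivity) (by rw [← Finset.sum_div, div_self hZp.ne']) (fun i _ => trivial)
  simp only [smul_eq_mul] at hJ
  have h2 : ∑ i ∈ s, Real.exp (-v i) / Z * Real.exp (v i) = s.card / Z := by
    rw [Finset.sum_congr rfl (g := fun _ => 1 / Z)]
    · simp; ring
    · intro i _; rw [div_mul_eq_mul_div, ← Real.exp_add]; simp
  rw [h2] at hJ
  have h3 : (s.card : ℝ) / Z ≤ s.card * Real.exp (v i₀) := by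
    rw [div_le_iff₀ hZp, mul_assoc]
    have : 1 ≤ Real.exp (v i₀) * Z := by
      calc 1 = Real.exp (v i₀) * Real.exp (-v i₀) := by rw [← Real.exp_add]; simp
        _ ≤ _ := by gcongr
    nlinarith
  rw [← Real.exp_le_exp, Real.exp_add, Real.exp_log hc, mul_comm (Real.exp (v i₀))]
  exact hJ.trans h3

end Decoupling

/-! ### One exploration step -/

section Step

variable {d : ℕ} {X : Finset (Vec d)} {M : Set (Vec d)} {c : Choices d} {h : Data d}

/-- The confidence width `β_{s,s²}^{1/2} ‖x‖_{V_s⁻¹}`. -/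
def width (h : Data d) (x : Vec d) : ℝ := radius h * √(quadSq (gram h)⁻¹ x)

lemma one_le_sqrtBeta (h : Data d) (r : ℝ) : 1 ≤ sqrtBeta h r := by
  have := Real.sqrt_nonneg (2 * Real.log r + Real.log (gram h).det)
  rw [sqrtBeta]; linarith

lemma radius_pos (h : Data d) : 0 < radius h := one_pos.trans_le (one_le_sqrtBeta h _)

lemma width_nonneg (h : Data d) (x : Vec d) : 0 ≤ width h x :=
  mul_nonneg (radius_pos h).le (Real.sqrt_nonneg _)

lemma le_gapEst {z : Vec d} (hz : z ∈ X) (x : Vec d) :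
    ⟪z, lsq h⟫ + width h z - ⟪x, lsq h⟫ ≤ gapEst X h x := by
  have := le_ciSup (f := fun z : X => ⟪z.1, lsq h⟫ + radius h * √(quadSq (gram h)⁻¹ z.1))
    (Set.finite_range _).bddAbove ⟨z, hz⟩
  simp only [gapEst, width] at this ⊢
  linarith

lemma width_le_gapEst {x : Vec d} (hx : x ∈ X) : width h x ≤ gapEst X h x := by
  have := le_gapEst (h := h) hx x; linarith

lemma gapEst_nonneg {x : Vec d} (hx : x ∈ X) : 0 ≤ gapEst X h x :=
  (width_nonneg h x).trans (width_le_gapEst hx)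

lemma exists_gapEst_eq_width (hX : X.Nonempty) : ∃ x ∈ X, gapEst X h x = width h x := by
  have : Nonempty X := hX.to_subtype
  obtain ⟨z, hz⟩ := exists_eq_ciSup_of_finite
    (f := fun z : X => ⟪z.1, lsq h⟫ + radius h * √(quadSq (gram h)⁻¹ z.1))
  exact ⟨z, z.2, by rw [gapEst, ← hz, width]; ring⟩

lemma gapEst_eq_add (X : Finset (Vec d)) (h : Data d) (x y : Vec d) :
    gapEst X h x = gapEst X h y + ⟪y - x, lsq h⟫ := by
  simp only [gapEst, inner_sub_left]; ring

lemma gapEst_xhat_le (hc : IsIDS X M c) {x : Vec d} (hx : x ∈ X) :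
    gapEst X h (c.xhat h) ≤ gapEst X h x := by
  rw [gapEst_eq_add X h x (c.xhat h), inner_sub_left]
  linarith [hc.xhat_max h x hx]

lemma altSq_nonneg (c : Choices d) (h : Data d) (z : Vec d) : 0 ≤ altSq c h z := gram_nonneg h _

lemma exists_minAlt_eq (hne : (alts X M c h).Nonempty) :
    ∃ z ∈ alts X M c h, (∀ w ∈ alts X M c h, altSq c h z ≤ altSq c h w) ∧
      minAlt X M c h = ENNReal.ofReal (altSq c h z / 2) := by
  obtain ⟨z, hz, hmin⟩ := Finset.exists_min_image _ (altSq c h) hne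
  refine ⟨z, hz, hmin, le_antisymm (iInf₂_le z hz) (le_iInf₂ fun w hw => ?_)⟩
  exact ENNReal.ofReal_le_ofReal (by linarith [hmin w hw])

lemma alts_nonempty (hm : minAlt X M c h ≠ ⊤) : (alts X M c h).Nonempty := by
  rw [Finset.nonempty_iff_ne_empty]
  intro he
  exact hm (by simp [minAlt, he])

lemma learningRate_le (X : Finset (Vec d)) (M : Set (Vec d)) (c : Choices d) (h : Data d) :
    learningRate X M c h ≤ minAlt X M c h ^ (-(1 / 2) : ℝ) * ENNReal.ofReal (Real.log X.card) := by
  cases h with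
  | nil => exact le_rfl
  | cons p h => exact min_le_left _ _

/-- `η_s` is a running minimum, so a lower bound needs every earlier `m_l` to be bounded above;
hence the hypothesis on all suffixes. -/
lemma le_learningRate {m : ℝ≥0∞} (hm : ∀ h', h' <:+ h → minAlt X M c h' ≤ m) :
    m ^ (-(1 / 2) : ℝ) * ENNReal.ofReal (Real.log X.card) ≤ learningRate X M c h := by
  have key : ∀ h', h' <:+ h → m ^ (-(1 / 2) : ℝ) * ENNReal.ofReal (Real.log X.card)
      ≤ minAlt X M c h' ^ (-(1 / 2) : ℝ) * ENNReal.ofReal (Real.log X.card) := by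
    intro h' hh
    gcongr ?_ * _
    rw [ENNReal.rpow_neg, ENNReal.rpow_neg]
    exact ENNReal.inv_le_inv.mpr (ENNReal.rpow_le_rpow (hm h' hh) (by norm_num))
  induction h with
  | nil => exact key [] List.suffix_rfl
  | cons p h ih =>
    refine le_min (key _ List.suffix_rfl) (ih (fun h' hh => hm h' (hh.trans (List.suffix_cons p h)))
      fun h' hh => key h' (hh.trans (List.suffix_cons p h)))

lemma expWeight_nonneg (η : ℝ≥0∞) (a : ℝ) : 0 ≤ expWeight η a := by
  unfold expWeight; split_ifs <;> positivity

lemma mixWeight_nonneg (z : Vec d) : 0 ≤ mixWeight X M c h z :=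
  div_nonneg (expWeight_nonneg _ _) (Finset.sum_nonneg fun _ _ => expWeight_nonneg _ _)

/-- `η_s` is at most the term of the current data, so `η_s = ∞` forces `m_s = 0`. The weights at
infinite rate are therefore not all zero. -/
lemma exists_altSq_eq_zero (hne : (alts X M c h).Nonempty) (hη : learningRate X M c h = ⊤) :
    ∃ z ∈ alts X M c h, altSq c h z = 0 := by
  obtain ⟨z, hz, -, he⟩ := exists_minAlt_eq hne
  refine ⟨z, hz, le_antisymm ?_ (altSq_nonneg c h z)⟩
  have h1 := learningRate_le X M c h
  rw [hη, top_le_iff, ENNReal.mul_eq_top] at h1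
  have h2 : minAlt X M c h ^ (-(1 / 2) : ℝ) = ⊤ := by
    rcases h1 with h1 | h1
    · exact absurd h1.2 ENNReal.ofReal_ne_top
    · exact h1.1
  rw [ENNReal.rpow_eq_top_iff] at h2
  rcases h2 with h2 | h2
  · rw [he, ENNReal.ofReal_eq_zero] at h2; linarith [h2.1]
  · norm_num at h2

lemma sum_expWeight_pos (hne : (alts X M c h).Nonempty) :
    0 < ∑ w ∈ alts X M c h, expWeight (learningRate X M c h) (altSq c h w) := by
  by_cases hη : learningRate X M c h = ⊤
  · obtain ⟨z, hz, hz0⟩ := exists_altSq_eq_zero hne hη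
    refine Finset.sum_pos' (fun _ _ => expWeight_nonneg _ _) ⟨z, hz, ?_⟩
    simp [expWeight, hη, hz0]
  · refine Finset.sum_pos (fun z _ => ?_) hne
    simp only [expWeight, hη, if_false]; exact Real.exp_pos _

lemma sum_mixWeight (hne : (alts X M c h).Nonempty) :
    ∑ z ∈ alts X M c h, mixWeight X M c h z = 1 := by
  simp only [mixWeight]
  rw [← Finset.sum_div, div_self (sum_expWeight_pos hne).ne']

lemma alts_subset : alts X M c h ⊆ X := by
  intro z hz
  classical
  exact (Finset.mem_filter.mp hz).1

/-- If every `m_l`, `l ≤ s`, is at most `B/2`, the mean squared distance of the alternative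
parameters under the mixing weights is of order `B`. -/
lemma sum_mixWeight_altSq_le (hX : 2 ≤ X.card) {B : ℝ} (hB : 1 ≤ B)
    (hm : ∀ h', h' <:+ h → minAlt X M c h' ≤ ENNReal.ofReal (B / 2)) :
    ∑ z ∈ alts X M c h, mixWeight X M c h z * altSq c h z ≤ 3 * B := by
  have hne : (alts X M c h).Nonempty :=
    alts_nonempty ((hm h List.suffix_rfl).trans_lt ENNReal.ofReal_lt_top).ne
  -- At infinite rate only alternatives at distance zero carry weight, and the mean vanishes.
  by_cases hη : learningRate X M c h = ⊤
  · refine (Finset.sum_nonpos fun z _ => ?_).trans (by linarith)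
    by_cases hz : altSq c h z = 0
    · simp [hz]
    · simp [mixWeight, expWeight, hη, hz]
  obtain ⟨z₀, hz₀, -, he⟩ := exists_minAlt_eq hne
  have ha₀ : altSq c h z₀ ≤ B := by
    have := hm h List.suffix_rfl
    rw [he, ENNReal.ofReal_le_ofReal_iff (by linarith)] at this
    linarith
  set η := (learningRate X M c h).toReal with hηdef
  have hk : 0 < Real.log X.card := Real.log_pos (by exact_mod_cast hX)
  have hsB : 0 < √(B / 2) := Real.sqrt_pos.mpr (by linarith)
  have hηlow : Real.log X.card / √(B / 2) ≤ η := by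
    have h1 := le_learningRate hm
    rw [← ENNReal.ofReal_toReal hη, ENNReal.ofReal_rpow_of_pos (by linarith),
      ← ENNReal.ofReal_mul (by positivity), ENNReal.ofReal_le_ofReal_iff ENNReal.toReal_nonneg] at h1
    rwa [Real.rpow_neg (by linarith), ← Real.sqrt_eq_rpow, inv_mul_eq_div] at h1
  have hη0 : 0 < η := (div_pos hk hsB).trans_le hηlow
  have hw : ∀ z, expWeight (learningRate X M c h) (altSq c h z)
      = Real.exp (-(η / 2 * altSq c h z)) := fun z => by simp [expWeight, hη, hηdef]
  have h1 := sum_exp_weights_le (alts X M c h) (fun z => η / 2 * altSq c h z) hz₀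
  have h2 : ∑ z ∈ alts X M c h, Real.exp (-(η / 2 * altSq c h z)) /
      (∑ w ∈ alts X M c h, Real.exp (-(η / 2 * altSq c h w))) * (η / 2 * altSq c h z)
      = η / 2 * ∑ z ∈ alts X M c h, mixWeight X M c h z * altSq c h z := by
    rw [Finset.mul_sum]
    refine Finset.sum_congr rfl fun z _ => ?_
    simp only [mixWeight, hw]; ring
  rw [h2] at h1
  have h3 : Real.log (alts X M c h).card ≤ Real.log X.card :=
    Real.log_le_log (by exact_mod_cast hne.card_pos)
      (by exact_mod_cast Finset.card_le_card alts_subset)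
  have h4 : Real.log X.card ≤ η * √(B / 2) := (div_le_iff₀ hsB).mp hηlow
  have h5 : √(B / 2) ≤ B := by
    rw [Real.sqrt_le_left (by linarith)]; nlinarith
  -- One `B` comes from the minimal alternative and `2B` from the entropy: `log k ≤ η √(B/2) ≤ η B`
  -- is proportional to `η`, so `log k` disappears on division by `η / 2`.
  have h6 : η / 2 * ∑ z ∈ alts X M c h, mixWeight X M c h z * altSq c h z ≤ η / 2 * (3 * B) := by
    nlinarith [mul_le_mul_of_nonneg_left ha₀ hη0.le, mul_le_mul_of_nonneg_left h5 hη0.le]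
  exact le_of_mul_le_mul_left h6 (by linarith)

/-- Cauchy–Schwarz in the `V`-norm and `(a + b)² ≤ 2a² + 2b²` make each summand a multiple of
`‖x‖²_{V⁻¹}`; this ties the information gain to the elliptical potential. -/
lemma infoGain_le (hX : 2 ≤ X.card) {B : ℝ} (hB : 1 ≤ B)
    (hm : ∀ h', h' <:+ h → minAlt X M c h' ≤ ENNReal.ofReal (B / 2)) (x : Vec d) :
    infoGain X M c h x ≤ (3 * B + radius h ^ 2) * quadSq (gram h)⁻¹ x := by
  have hne : (alts X M c h).Nonempty :=
    alts_nonempty ((hm h List.suffix_rfl).trans_lt ENNReal.ofReal_lt_top).ne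
  set u := quadSq (gram h)⁻¹ x with hu
  have hu0 : 0 ≤ u := gram_inv_nonneg h x
  have hterm : ∀ z, (|⟪c.nu h z - lsq h, x⟫| + radius h * √u) ^ 2
      ≤ 2 * u * (altSq c h z + radius h ^ 2) := by
    intro z
    have h1 := inner_sq_le_quadSq_mul (gram_posDef h) (c.nu h z - lsq h) x
    have h2 : √u ^ 2 = u := Real.sq_sqrt hu0
    have h3 := add_sq_le (a := |⟪c.nu h z - lsq h, x⟫|) (b := radius h * √u)
    rw [sq_abs, mul_pow, h2] at h3
    rw [altSq]
    nlinarith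
  have h1 : ∑ z ∈ alts X M c h, mixWeight X M c h z *
      (|⟪c.nu h z - lsq h, x⟫| + radius h * √u) ^ 2
      ≤ ∑ z ∈ alts X M c h, mixWeight X M c h z * (2 * u * (altSq c h z + radius h ^ 2)) :=
    Finset.sum_le_sum fun z _ => mul_le_mul_of_nonneg_left (hterm z) (mixWeight_nonneg z)
  have h2 : ∑ z ∈ alts X M c h, mixWeight X M c h z * (2 * u * (altSq c h z + radius h ^ 2))
      = 2 * u * (∑ z ∈ alts X M c h, mixWeight X M c h z * altSq c h z + radius h ^ 2) := by
    have h3 : ∑ z ∈ alts X M c h, mixWeight X M c h z * radius h ^ 2 = radius h ^ 2 := by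
      rw [← Finset.sum_mul, sum_mixWeight hne, one_mul]
    nth_rewrite 2 [← h3]
    rw [← Finset.sum_add_distrib, Finset.mul_sum]
    exact Finset.sum_congr rfl fun z _ => by ring
  have h3 := sum_mixWeight_altSq_le hX hB hm
  rw [infoGain, ← hu]
  nlinarith [mul_le_mul_of_nonneg_left h3 hu0]

lemma infoGain_nonneg (x : Vec d) : 0 ≤ infoGain X M c h x :=
  mul_nonneg (by norm_num) (Finset.sum_nonneg fun z _ => mul_nonneg (mixWeight_nonneg z)
    (sq_nonneg _))

/-- The width inside the information gain serves to keep the information ratio of the optimistic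
action bounded. -/
lemma sq_width_le_infoGain (hne : (alts X M c h).Nonempty) (x : Vec d) :
    width h x ^ 2 ≤ 2 * infoGain X M c h x := by
  have h1 : ∑ z ∈ alts X M c h, mixWeight X M c h z * width h x ^ 2
      ≤ ∑ z ∈ alts X M c h, mixWeight X M c h z *
        (|⟪c.nu h z - lsq h, x⟫| + radius h * √(quadSq (gram h)⁻¹ x)) ^ 2 := by
    refine Finset.sum_le_sum fun z _ => mul_le_mul_of_nonneg_left ?_ (mixWeight_nonneg z)
    exact pow_le_pow_left₀ (width_nonneg h x) (le_add_of_nonneg_left (abs_nonneg _)) 2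
  rw [← Finset.sum_mul, sum_mixWeight hne, one_mul] at h1
  rw [infoGain]; linarith

lemma sum_inner_sq_le_infoGain (x : Vec d) :
    ∑ z ∈ alts X M c h, mixWeight X M c h z * ⟪c.nu h z - lsq h, x⟫ ^ 2
      ≤ 2 * infoGain X M c h x := by
  rw [infoGain, ← mul_assoc]; norm_num
  refine Finset.sum_le_sum fun z _ => mul_le_mul_of_nonneg_left ?_ (mixWeight_nonneg z)
  rw [← sq_abs]
  exact pow_le_pow_left₀ (abs_nonneg _) (le_add_of_nonneg_right (width_nonneg h x)) 2

section Optimality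

variable (X M c h) in
/-- Gap estimate of a distribution. -/
def meanGap (μ : Vec d → ℝ) : ℝ := ∑ x ∈ X, μ x * gapEst X h x

variable (X M c h) in
/-- Information gain of a distribution. -/
def meanInfo (μ : Vec d → ℝ) : ℝ := ∑ x ∈ X, μ x * infoGain X M c h x

lemma meanInfo_nonneg {μ : Vec d → ℝ} (hμ : IsDistr X μ) : 0 ≤ meanInfo X M c h μ :=
  Finset.sum_nonneg fun x hx => mul_nonneg (hμ.1 x hx) (infoGain_nonneg x)

lemma gapEst_xhat_le_meanGap (hc : IsIDS X M c) {μ : Vec d → ℝ} (hμ : IsDistr X μ) :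
    gapEst X h (c.xhat h) ≤ meanGap X h μ := by
  calc gapEst X h (c.xhat h) = ∑ x ∈ X, μ x * gapEst X h (c.xhat h) := by
        rw [← Finset.sum_mul, hμ.2, one_mul]
    _ ≤ _ := Finset.sum_le_sum fun x hx =>
        mul_le_mul_of_nonneg_left (gapEst_xhat_le hc hx) (hμ.1 x hx)

/-- Cross-multiplied optimality of the sampling distribution. -/
lemma sq_meanGap_mul_le (hc : IsIDS X M c) {μ : Vec d → ℝ} (hμ : IsDistr X μ) :
    meanGap X h (c.mu h) ^ 2 * meanInfo X M c h μ
      ≤ meanGap X h μ ^ 2 * meanInfo X M c h (c.mu h) := by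
  have hI := meanInfo_nonneg (M := M) (c := c) (h := h) hμ
  have hI₀ := meanInfo_nonneg (M := M) (c := c) (h := h) (hc.mu_distr h)
  rcases hI.eq_or_lt with h0 | h0
  · rw [← h0, mul_zero]; exact mul_nonneg (sq_nonneg _) hI₀
  have h1 : ENNReal.ofReal (meanGap X h (c.mu h) ^ 2) / ENNReal.ofReal (meanInfo X M c h (c.mu h))
      ≤ ENNReal.ofReal (meanGap X h μ ^ 2) / ENNReal.ofReal (meanInfo X M c h μ) := hc.mu_min h μ hμ
  have hfin : ENNReal.ofReal (meanGap X h μ ^ 2) / ENNReal.ofReal (meanInfo X M c h μ) ≠ ⊤ :=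
    ENNReal.div_ne_top ENNReal.ofReal_ne_top (by simpa using h0)
  rw [ENNReal.div_le_iff_le_mul (Or.inr hfin) (Or.inl ENNReal.ofReal_ne_top),
    ← ENNReal.ofReal_div_of_pos h0, ← ENNReal.ofReal_mul (by positivity),
    ENNReal.ofReal_le_ofReal_iff (by positivity), div_mul_eq_mul_div, le_div_iff₀ h0] at h1
  exact h1

/-- A minimal ratio `0` excludes a positive gap because `a / 0 = ∞`. The cross-multiplied inequality
says nothing here if `μ` also has zero information. -/
lemma meanGap_eq_zero (hc : IsIDS X M c) {μ : Vec d → ℝ} (hμ : IsDistr X μ)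
    (h0 : meanGap X h μ = 0) : meanGap X h (c.mu h) = 0 := by
  have h1 : ENNReal.ofReal (meanGap X h (c.mu h) ^ 2) / ENNReal.ofReal (meanInfo X M c h (c.mu h))
      ≤ ENNReal.ofReal (meanGap X h μ ^ 2) / ENNReal.ofReal (meanInfo X M c h μ) := hc.mu_min h μ hμ
  rw [h0] at h1
  simpa using h1

lemma isDistr_single {x : Vec d} (hx : x ∈ X) [DecidableEq (Vec d)] :
    IsDistr X fun y => if y = x then 1 else 0 :=
  ⟨fun y _ => by dsimp only; split_ifs <;> norm_num, by simp [hx]⟩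

/-- Comparison with the optimistic action: the optimal information ratio is at most `2`. -/
lemma sq_meanGap_le (hc : IsIDS X M c) (hne : (alts X M c h).Nonempty) :
    meanGap X h (c.mu h) ^ 2 ≤ 2 * meanInfo X M c h (c.mu h) := by
  classical
  obtain ⟨z, hz, he⟩ := exists_gapEst_eq_width (h := h) ⟨_, hc.xhat_mem h⟩
  have hμ := isDistr_single hz
  have hD : meanGap X h (fun y => if y = z then 1 else 0) = width h z := by
    simp [meanGap, hz, he]
  have hI : meanInfo X M c h (fun y => if y = z then 1 else 0) = infoGain X M c h z := by
    simp [meanInfo, hz]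
  have hI₀ := meanInfo_nonneg (M := M) (c := c) (h := h) (hc.mu_distr h)
  rcases (width_nonneg h z).eq_or_lt with h0 | h0
  · rw [meanGap_eq_zero hc hμ (hD.trans h0.symm)]; nlinarith
  · have h1 := sq_meanGap_mul_le hc hμ (h := h)
    rw [hD, hI] at h1
    have h2 := sq_width_le_infoGain hne z
    have h3 : width h z ^ 2 * meanGap X h (c.mu h) ^ 2
        ≤ width h z ^ 2 * (2 * meanInfo X M c h (c.mu h)) := by
      nlinarith [mul_le_mul_of_nonneg_left h2 (sq_nonneg (meanGap X h (c.mu h)))]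
    exact le_of_mul_le_mul_left h3 (by positivity)

variable (X M c h) in
/-- Mean empirical gap of the alternatives under the mixing weights. -/
def mixGap : ℝ := ∑ z ∈ alts X M c h, mixWeight X M c h z * ⟪c.xhat h - z, lsq h⟫

lemma mem_alts {z : Vec d} : z ∈ alts X M c h ↔
    z ∈ X ∧ z ≠ c.xhat h ∧ (halfspace M (c.xhat h) z).Nonempty := by
  simp [alts]

lemma mixGap_nonneg (hc : IsIDS X M c) : 0 ≤ mixGap X M c h := by
  refine Finset.sum_nonneg fun z hz => mul_nonneg (mixWeight_nonneg z) ?_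
  rw [inner_sub_left]
  linarith [hc.xhat_max h z (alts_subset hz)]

/-- The alternatives and the empirically best action together are informative. -/
lemma sq_mixGap_le (hc : IsIDS X M c) (hne : (alts X M c h).Nonempty) :
    mixGap X M c h ^ 2 ≤ 4 * d * (infoGain X M c h (c.xhat h)
      + ∑ z ∈ alts X M c h, mixWeight X M c h z * infoGain X M c h z) := by
  set q := mixWeight X M c h
  set w : Vec d → Vec d := fun z => c.nu h z - lsq h
  set a := ∑ z ∈ alts X M c h, q z * ⟪w z, z⟫
  set b := ∑ z ∈ alts X M c h, q z * ⟪w z, c.xhat h⟫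
  have hd : (1 : ℝ) ≤ d := by
    obtain ⟨z, hz⟩ := hne
    have h1 := (mem_alts.mp hz).2.1
    rcases Nat.eq_zero_or_pos d with h0 | h0
    · subst h0; exact absurd (Subsingleton.elim _ _) h1
    · exact_mod_cast h0
  -- As `⟨z - x̂, ν̂(z)⟩ ≥ 0`, the empirical gap of `z` is at most `⟨ν̂(z) - θ̂, z - x̂⟩`. The part
  -- along `z` needs decoupling because `ν̂(z)` varies with `z`; the part along the fixed `x̂` needs
  -- only Jensen.
  have h1 : mixGap X M c h ≤ a - b := by
    rw [← Finset.sum_sub_distrib]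
    refine Finset.sum_le_sum fun z hz => ?_
    rw [← mul_sub]
    refine mul_le_mul_of_nonneg_left ?_ (mixWeight_nonneg z)
    have := (hc.nu_mem h z hz).2
    simp only [w, inner_sub_left] at this ⊢
    rw [real_inner_comm _ (c.nu h z), real_inner_comm _ (c.nu h z), real_inner_comm _ (lsq h),
      real_inner_comm _ (lsq h)]
    linarith
  have ha : a ^ 2 ≤ d * (2 * ∑ z ∈ alts X M c h, q z * infoGain X M c h z) := by
    refine (sq_sum_inner_le _ q (fun z _ => mixWeight_nonneg z) w fun z => z).trans ?_
    rw [Finset.mul_sum (a := (2 : ℝ))]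
    refine mul_le_mul_of_nonneg_left (Finset.sum_le_sum fun z _ => ?_) (by linarith)
    rw [mul_left_comm (2 : ℝ)]
    exact mul_le_mul_of_nonneg_left (sum_inner_sq_le_infoGain z) (mixWeight_nonneg z)
  have hb : b ^ 2 ≤ 2 * infoGain X M c h (c.xhat h) :=
    (sq_sum_mul_le _ q _ (fun z _ => mixWeight_nonneg z) (sum_mixWeight hne)).trans
      (sum_inner_sq_le_infoGain _)
  have hI := infoGain_nonneg (X := X) (M := M) (c := c) (h := h) (c.xhat h)
  have h2 : mixGap X M c h ^ 2 ≤ (a - b) ^ 2 := pow_le_pow_left₀ (mixGap_nonneg hc) h1 2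
  nlinarith [sq_nonneg (a + b)]

/-- Comparison with a mixture of the empirically best action and the alternatives. -/
lemma mixGap_mul_meanGap_le (hc : IsIDS X M c) (hne : (alts X M c h).Nonempty)
    (hδ : 2 * gapEst X h (c.xhat h) ≤ mixGap X M c h) :
    mixGap X M c h * meanGap X h (c.mu h) ≤ 16 * d * meanInfo X M c h (c.mu h) := by
  classical
  set δ := gapEst X h (c.xhat h) with hδdef
  set G := mixGap X M c h with hG
  set D := meanGap X h (c.mu h) with hD
  set I := meanInfo X M c h (c.mu h) with hIdef
  have hI0 : 0 ≤ I := meanInfo_nonneg (hc.mu_distr h)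
  have hx := hc.xhat_mem h
  have hδ0 : 0 ≤ δ := gapEst_nonneg hx
  have hδD : δ ≤ D := gapEst_xhat_le_meanGap hc (hc.mu_distr h)
  rcases hδ0.eq_or_lt with h0 | h0
  · have : D = 0 := meanGap_eq_zero hc (isDistr_single hx) (by simp [meanGap, hx, ← hδdef, ← h0])
    rw [this, mul_zero]; positivity
  have hG0 : 0 < G := by linarith
  -- This `p` doubles the gap estimate: `δ + pG = 2δ`. Since `p ≤ 1/2`, the weight `1 - p` of `x̂`
  -- is at least `p`, as required to use `sq_mixGap_le`.
  set p := δ / G with hp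
  have hp0 : 0 < p := div_pos h0 hG0
  have hp1 : p ≤ 1 / 2 := by rw [hp, div_le_iff₀ hG0]; linarith
  set q : Vec d → ℝ := fun z => if z ∈ alts X M c h then mixWeight X M c h z else 0 with hq
  have hqsum : ∀ f : Vec d → ℝ, ∑ z ∈ X, q z * f z
      = ∑ z ∈ alts X M c h, mixWeight X M c h z * f z := by
    intro f
    simp only [hq, ite_mul, zero_mul]
    rw [← Finset.sum_filter, Finset.filter_mem_eq_inter, Finset.inter_eq_right.mpr alts_subset]
  have hq0 : ∀ z, 0 ≤ q z := fun z => by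
    simp only [hq]; split_ifs
    · exact mixWeight_nonneg z
    · exact le_rfl
  have hq1 : ∑ z ∈ X, q z = 1 := by
    have := hqsum fun _ => 1
    simpa [sum_mixWeight hne] using this
  set μ : Vec d → ℝ := fun z => (1 - p) * (if z = c.xhat h then 1 else 0) + p * q z with hμ
  have hμsum : ∀ f : Vec d → ℝ, ∑ z ∈ X, μ z * f z = (1 - p) * f (c.xhat h)
      + p * ∑ z ∈ alts X M c h, mixWeight X M c h z * f z := by
    intro f
    rw [← hqsum f, Finset.mul_sum]
    simp only [hμ, add_mul, Finset.sum_add_distrib, mul_assoc, ite_mul, one_mul, zero_mul, mul_ite,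
      mul_zero, Finset.sum_ite_eq', hx, if_true]
  have hμd : IsDistr X μ := by
    refine ⟨fun z _ => ?_, ?_⟩
    · have := hq0 z
      simp only [hμ]; split_ifs <;> nlinarith [mul_nonneg hp0.le this]
    · have := hμsum fun _ => 1
      simp only [mul_one, sum_mixWeight hne] at this
      linarith
  have hgap : meanGap X h μ = 2 * δ := by
    rw [meanGap, hμsum, ← hδdef]
    have : ∑ z ∈ alts X M c h, mixWeight X M c h z * gapEst X h z = δ + G := by
      have h3 : ∑ z ∈ alts X M c h, mixWeight X M c h z * δ = δ := by
        rw [← Finset.sum_mul, sum_mixWeight hne, one_mul]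
      conv_rhs => rw [← h3]
      rw [hG, mixGap, ← Finset.sum_add_distrib]
      refine Finset.sum_congr rfl fun z _ => ?_
      rw [gapEst_eq_add X h z (c.xhat h)]; ring
    rw [this, hp]; field_simp; ring
  have hinfo : p * G ^ 2 ≤ 4 * d * meanInfo X M c h μ := by
    have h1 := sq_mixGap_le hc hne
    rw [meanInfo, hμsum]
    have hi := infoGain_nonneg (X := X) (M := M) (c := c) (h := h) (c.xhat h)
    have hd : (0 : ℝ) ≤ d := Nat.cast_nonneg d
    have h2 : p * infoGain X M c h (c.xhat h) ≤ (1 - p) * infoGain X M c h (c.xhat h) :=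
      mul_le_mul_of_nonneg_right (by linarith) hi
    nlinarith [mul_le_mul_of_nonneg_left h1 hp0.le, mul_le_mul_of_nonneg_left h2 hd]
  have hopt := sq_meanGap_mul_le hc hμd (h := h)
  rw [hgap, ← hD, ← hIdef] at hopt
  have hpG : p * G ^ 2 = δ * G := by rw [hp]; field_simp
  rw [hpG] at hinfo
  have hd : (0 : ℝ) ≤ d := Nat.cast_nonneg d
  have h3 : D ^ 2 * (δ * G) ≤ 4 * d * ((2 * δ) ^ 2 * I) := by
    nlinarith [mul_le_mul_of_nonneg_left hinfo (sq_nonneg D), mul_le_mul_of_nonneg_left hopt hd]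
  have hDp : 0 < D := h0.trans_le hδD
  -- One factor `δ` is traded for `D ≥ δ`; after division by `δ D` the bound is linear in `D`.
  have h4 : δ * D * (G * D) ≤ δ * D * (16 * d * I) := by
    have : δ * δ * (16 * d * I) ≤ δ * D * (16 * d * I) :=
      mul_le_mul_of_nonneg_right (mul_le_mul_of_nonneg_left hδD h0.le) (by positivity)
    nlinarith
  exact le_of_mul_le_mul_left h4 (by positivity)

variable {θ xstar : Vec d}

lemma abs_inner_sub_le_width (hgood : √(quadSq (gram h) (lsq h - θ)) ≤ radius h) (x : Vec d) :
    |⟪x, lsq h - θ⟫| ≤ width h x := by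
  rw [real_inner_comm]
  exact (abs_inner_le_quadSq (gram_posDef h) _ _).trans
    (mul_le_mul_of_nonneg_right hgood (Real.sqrt_nonneg _))

/-- On the confidence event the true gaps are at most twice their estimates. -/
lemma gap_le_two_mul_gapEst (hgood : √(quadSq (gram h) (lsq h - θ)) ≤ radius h)
    (hs : xstar ∈ X) {a : Vec d} (ha : a ∈ X) : ⟪xstar - a, θ⟫ ≤ 2 * gapEst X h a := by
  have h1 := abs_le.mp (abs_inner_sub_le_width hgood xstar)
  have h2 := abs_le.mp (abs_inner_sub_le_width hgood a)
  have h3 := le_gapEst (h := h) hs a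
  have h4 := width_le_gapEst (h := h) ha
  rw [inner_sub_right] at h1 h2
  rw [inner_sub_left]
  linarith [h1.1, h2.2]

/-- Gap-dependent bound on the estimated regret of an exploration step. -/
lemma minGap_mul_meanGap_le (hc : IsIDS X M c) (hne : (alts X M c h).Nonempty)
    (hgood : √(quadSq (gram h) (lsq h - θ)) ≤ radius h) (hs : xstar ∈ X) {Δ : ℝ}
    (hgap : ∀ a ∈ X, a ≠ xstar → Δ ≤ ⟪xstar - a, θ⟫) :
    Δ * meanGap X h (c.mu h) ≤ 64 * d * meanInfo X M c h (c.mu h) := by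
  set δ := gapEst X h (c.xhat h) with hδdef
  set G := mixGap X M c h with hG
  set D := meanGap X h (c.mu h) with hD
  set I := meanInfo X M c h (c.mu h) with hIdef
  have hI0 : 0 ≤ I := meanInfo_nonneg (hc.mu_distr h)
  have hx := hc.xhat_mem h
  have hδ0 : 0 ≤ δ := gapEst_nonneg hx
  have hδD : δ ≤ D := gapEst_xhat_le_meanGap hc (hc.mu_distr h)
  have hD2 : D ^ 2 ≤ 2 * I := sq_meanGap_le hc hne
  have hd : (1 : ℝ) ≤ d := by
    obtain ⟨z, hz⟩ := hne
    have h1 := (mem_alts.mp hz).2.1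
    rcases Nat.eq_zero_or_pos d with h0 | h0
    · subst h0; exact absurd (Subsingleton.elim _ _) h1
    · exact_mod_cast h0
  have hdI : I ≤ d * I := by nlinarith
  -- Here `δ ≤ D` gives `Δ D ≤ 4 D² ≤ 8 I`: the optimistic comparison suffices.
  by_cases hlarge : Δ ≤ 4 * δ
  · nlinarith [mul_le_mul_of_nonneg_right hlarge (hδ0.trans hδD),
      mul_le_mul_of_nonneg_right hδD (hδ0.trans hδD)]
  push Not at hlarge
  have hxs : c.xhat h = xstar := by
    by_contra hne'
    have h1 := hgap _ hx hne'
    have h2 := gap_le_two_mul_gapEst hgood hs hx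
    rw [← hδdef] at h2
    linarith
  -- Every alternative satisfies `Δ ≤ 2 (δ + ⟨x̂ - z, θ̂⟩)`, and `δ < Δ / 4`.
  have hGΔ : Δ / 4 ≤ G := by
    calc Δ / 4 = ∑ z ∈ alts X M c h, mixWeight X M c h z * (Δ / 4) := by
          rw [← Finset.sum_mul, sum_mixWeight hne, one_mul]
      _ ≤ G := by
        refine Finset.sum_le_sum fun z hz => mul_le_mul_of_nonneg_left ?_ (mixWeight_nonneg z)
        obtain ⟨hzX, hzne, -⟩ := mem_alts.mp hz
        have h1 := hgap z hzX (hxs ▸ hzne)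
        have h2 := gap_le_two_mul_gapEst hgood hs hzX
        rw [gapEst_eq_add X h z (c.xhat h), ← hδdef] at h2
        linarith
  -- The mixture comparison requires `δ / G ≤ 1/2`. Otherwise `Δ ≤ 4G < 8δ`, and `D² ≤ 2I` is again
  -- enough.
  by_cases hsmall : 2 * δ ≤ G
  · have := mixGap_mul_meanGap_le hc hne hsmall
    nlinarith [mul_le_mul_of_nonneg_right hGΔ (hδ0.trans hδD)]
  · push Not at hsmall
    nlinarith [mul_le_mul_of_nonneg_right hGΔ (hδ0.trans hδD),
      mul_le_mul_of_nonneg_right hsmall.le (hδ0.trans hδD),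
      mul_le_mul_of_nonneg_right hδD (hδ0.trans hδD)]

/-- Gap-dependent bound on the regret of an exploration step. -/
lemma minGap_mul_regret_le (hc : IsIDS X M c) (hX : 2 ≤ X.card) {B : ℝ} (hB : 1 ≤ B)
    (hm : ∀ h', h' <:+ h → minAlt X M c h' ≤ ENNReal.ofReal (B / 2))
    (hgood : √(quadSq (gram h) (lsq h - θ)) ≤ radius h) (hs : xstar ∈ X) {Δ : ℝ} (hΔ : 0 ≤ Δ)
    (hgap : ∀ a ∈ X, a ≠ xstar → Δ ≤ ⟪xstar - a, θ⟫) :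
    Δ * ∑ a ∈ X, c.mu h a * ⟪xstar - a, θ⟫
      ≤ 128 * d * (3 * B + radius h ^ 2) * ∑ a ∈ X, c.mu h a * quadSq (gram h)⁻¹ a := by
  have hne : (alts X M c h).Nonempty :=
    alts_nonempty ((hm h List.suffix_rfl).trans_lt ENNReal.ofReal_lt_top).ne
  have hμ := hc.mu_distr h
  have h1 : ∑ a ∈ X, c.mu h a * ⟪xstar - a, θ⟫ ≤ 2 * meanGap X h (c.mu h) := by
    rw [meanGap, Finset.mul_sum]
    refine Finset.sum_le_sum fun a ha => ?_
    rw [mul_left_comm]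
    exact mul_le_mul_of_nonneg_left (gap_le_two_mul_gapEst hgood hs ha) (hμ.1 a ha)
  have h2 : meanInfo X M c h (c.mu h)
      ≤ (3 * B + radius h ^ 2) * ∑ a ∈ X, c.mu h a * quadSq (gram h)⁻¹ a := by
    rw [meanInfo, Finset.mul_sum]
    refine Finset.sum_le_sum fun a ha => ?_
    rw [mul_left_comm]
    exact mul_le_mul_of_nonneg_left (infoGain_le hX hB hm a) (hμ.1 a ha)
  have h3 := minGap_mul_meanGap_le hc hne hgood hs hgap
  have hd : (0 : ℝ) ≤ d := Nat.cast_nonneg d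
  nlinarith [mul_le_mul_of_nonneg_left h1 hΔ, mul_le_mul_of_nonneg_left h2 hd]

end Optimality

end Step

/-! ### Conditionally subgaussian variables -/

section Subgaussian

/-- The Gaussian mixture of the exponential martingale increments in one dimension. -/
lemma lintegral_exp_gaussianReal (b e : ℝ) {u : ℝ} (hu : 0 ≤ u) :
    ∫⁻ g, ENNReal.ofReal (Real.exp ((b + √u * g) * e - (b + √u * g) ^ 2 / 2))
        ∂(ProbabilityTheory.gaussianReal 0 1)
      = ENNReal.ofReal (Real.exp ((2 * b * e + u * e ^ 2 - b ^ 2) / (1 + u) / 2) / √(1 + u)) := by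
  have hu1 : (0 : ℝ) < 1 + u := by linarith
  set v : NNReal := ⟨(1 + u)⁻¹, by positivity⟩ with hv
  have hv0 : v ≠ 0 := by
    intro h
    have : (1 + u)⁻¹ = 0 := congrArg NNReal.toReal h
    exact (inv_pos.mpr hu1).ne' this
  have hvc : (v : ℝ) = (1 + u)⁻¹ := rfl
  -- Completing the square in `g`: the integrand times the standard density is the claimed constant
  -- times a Gaussian density with mean `m` and variance `1 / (1 + u)`.
  set m : ℝ := √u * (e - b) / (1 + u) with hm
  rw [ProbabilityTheory.gaussianReal_of_var_ne_zero _ one_ne_zero,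
    lintegral_withDensity_eq_lintegral_mul _ (ProbabilityTheory.measurable_gaussianPDF _ _)
      (by fun_prop)]
  have key : ∀ g : ℝ, (ProbabilityTheory.gaussianPDF 0 1 * fun g =>
      ENNReal.ofReal (Real.exp ((b + √u * g) * e - (b + √u * g) ^ 2 / 2))) g
      = ENNReal.ofReal (Real.exp ((2 * b * e + u * e ^ 2 - b ^ 2) / (1 + u) / 2) / √(1 + u))
        * ProbabilityTheory.gaussianPDF m v g := by
    intro g
    rw [Pi.mul_apply, ProbabilityTheory.gaussianPDF, ProbabilityTheory.gaussianPDF,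
      ← ENNReal.ofReal_mul (ProbabilityTheory.gaussianPDFReal_nonneg _ _ _),
      ← ENNReal.ofReal_mul (by positivity)]
    congr 1
    rw [ProbabilityTheory.gaussianPDFReal, ProbabilityTheory.gaussianPDFReal, hvc]
    have h1 : √(2 * Real.pi * (1 + u)⁻¹) = √(2 * Real.pi) / √(1 + u) := by
      rw [← Real.sqrt_div (by positivity), div_eq_mul_inv]
    have h2 : (0 : ℝ) < √(1 + u) := Real.sqrt_pos.mpr hu1
    have h3 : (0 : ℝ) < √(2 * Real.pi) := Real.sqrt_pos.mpr (by positivity)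
    have h4 : √u ^ 2 = u := Real.sq_sqrt hu
    rw [h1, NNReal.coe_one, mul_one, mul_assoc, ← Real.exp_add]
    have h5 : -(g - 0) ^ 2 / (2 * 1) + ((b + √u * g) * e - (b + √u * g) ^ 2 / 2)
        = (2 * b * e + u * e ^ 2 - b ^ 2) / (1 + u) / 2 + -(g - m) ^ 2 / (2 * (1 + u)⁻¹) := by
      rw [hm]
      generalize √u = r at *
      subst h4
      field_simp
      ring
    rw [h5, Real.exp_add]
    field_simp
  rw [lintegral_congr key, lintegral_const_mul _ (ProbabilityTheory.measurable_gaussianPDF _ _),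
    ProbabilityTheory.lintegral_gaussianPDF_eq_one _ hv0, mul_one]

variable {Ω : Type*} {G mΩ : MeasurableSpace Ω} {P : Measure Ω} [IsProbabilityMeasure P]
  {ε : Ω → ℝ}

/-- `ε` is 1-subgaussian conditionally on `G`. -/
def CondSubgaussian (P : Measure Ω) (G : MeasurableSpace Ω) (ε : Ω → ℝ) : Prop :=
  ∀ r : ℝ, Integrable (fun ω => Real.exp (r * ε ω)) P ∧
    P[fun ω => Real.exp (r * ε ω) | G] ≤ᵐ[P] fun _ => Real.exp (r ^ 2 / 2)

lemma CondSubgaussian.setLIntegral_le (hε : CondSubgaussian P G ε) (hG : G ≤ mΩ) (r : ℝ)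
    {A : Set Ω} (hA : MeasurableSet[G] A) :
    ∫⁻ ω in A, ENNReal.ofReal (Real.exp (r * ε ω - r ^ 2 / 2)) ∂P ≤ P A := by
  obtain ⟨hint, hle⟩ := hε r
  have h1 : ∫ ω in A, Real.exp (r * ε ω) ∂P ≤ Real.exp (r ^ 2 / 2) * P.real A := by
    rw [← setIntegral_condExp hG hint hA]
    calc ∫ ω in A, (P[fun ω => Real.exp (r * ε ω) | G]) ω ∂P
        ≤ ∫ _ω in A, Real.exp (r ^ 2 / 2) ∂P :=
          integral_mono_ae integrable_condExp.integrableOn (integrable_const _)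
            (ae_restrict_of_ae hle)
      _ = _ := by simp [mul_comm]
  have h2 : ∀ ω, Real.exp (r * ε ω - r ^ 2 / 2)
      = Real.exp (-(r ^ 2 / 2)) * Real.exp (r * ε ω) := fun ω => by
    rw [← Real.exp_add]; ring_nf
  rw [← ofReal_integral_eq_lintegral_ofReal (by simp_rw [h2]; exact hint.integrableOn.const_mul _)
    (ae_of_all _ fun _ => (Real.exp_pos _).le), ← ENNReal.ofReal_toReal (measure_ne_top P A)]
  refine ENNReal.ofReal_le_ofReal ?_
  simp_rw [h2]
  rw [integral_const_mul]
  calc Real.exp (-(r ^ 2 / 2)) * ∫ ω in A, Real.exp (r * ε ω) ∂P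
      ≤ Real.exp (-(r ^ 2 / 2)) * (Real.exp (r ^ 2 / 2) * P.real A) := by gcongr
    _ = P.real A := by rw [← mul_assoc, ← Real.exp_add]; simp

/-- Restricted to `G`, the measure tilted by the exponential is dominated by `P`; so any
`G`-measurable weight may be integrated, with no integrability assumption. -/
lemma CondSubgaussian.lintegral_mul_exp_const_le (hε : CondSubgaussian P G ε) (hG : G ≤ mΩ)
    (hm : Measurable ε) (r : ℝ) {W : Ω → ℝ≥0∞} (hW : Measurable[G] W) :
    ∫⁻ ω, W ω * ENNReal.ofReal (Real.exp (r * ε ω - r ^ 2 / 2)) ∂P ≤ ∫⁻ ω, W ω ∂P := by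
  have hf : Measurable fun ω => ENNReal.ofReal (Real.exp (r * ε ω - r ^ 2 / 2)) := by fun_prop
  have hle : (P.withDensity fun ω => ENNReal.ofReal (Real.exp (r * ε ω - r ^ 2 / 2))).trim hG
      ≤ P.trim hG := by
    refine (@Measure.le_iff _ G _ _).mpr fun A hA => ?_
    rw [trim_measurableSet_eq hG hA, trim_measurableSet_eq hG hA,
      withDensity_apply _ (hG A hA)]
    exact hε.setLIntegral_le hG r hA
  calc ∫⁻ ω, W ω * ENNReal.ofReal (Real.exp (r * ε ω - r ^ 2 / 2)) ∂P
      = ∫⁻ ω, W ω ∂(P.withDensity fun ω => ENNReal.ofReal (Real.exp (r * ε ω - r ^ 2 / 2))) := by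
        rw [lintegral_withDensity_eq_lintegral_mul _ hf (hW.mono hG le_rfl)]
        simp only [Pi.mul_apply, mul_comm]
    _ = ∫⁻ ω, W ω ∂((P.withDensity fun ω =>
          ENNReal.ofReal (Real.exp (r * ε ω - r ^ 2 / 2))).trim hG) := (lintegral_trim hG hW).symm
    _ ≤ ∫⁻ ω, W ω ∂(P.trim hG) := lintegral_mono' hle le_rfl
    _ = _ := lintegral_trim hG hW

/-- A `G`-measurable exponent is approximated by simple functions, for which the constant case
applies on each level set; Fatou passes to the limit. -/
lemma CondSubgaussian.lintegral_mul_exp_le (hε : CondSubgaussian P G ε) (hG : G ≤ mΩ)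
    (hm : Measurable ε) {Λ : Ω → ℝ} (hΛ : Measurable[G] Λ) {W : Ω → ℝ≥0∞}
    (hW : Measurable[G] W) :
    ∫⁻ ω, W ω * ENNReal.ofReal (Real.exp (Λ ω * ε ω - Λ ω ^ 2 / 2)) ∂P ≤ ∫⁻ ω, W ω ∂P := by
  have hWm : Measurable W := hW.mono hG le_rfl
  have hsm : StronglyMeasurable[G] Λ := hΛ.stronglyMeasurable
  set s := hsm.approx with hs
  have hsmeas : ∀ j, Measurable (s j) := fun j =>
    (@SimpleFunc.measurable _ _ G _ (s j)).mono hG le_rfl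
  have hsimple : ∀ j, ∫⁻ ω, W ω * ENNReal.ofReal (Real.exp (s j ω * ε ω - s j ω ^ 2 / 2)) ∂P
      ≤ ∫⁻ ω, W ω ∂P := by
    intro j
    have hfib : ∀ r, MeasurableSet[G] (s j ⁻¹' {r}) := fun r =>
      @SimpleFunc.measurableSet_fiber _ _ G (s j) r
    have hdec : ∀ f : ℝ → Ω → ℝ≥0∞, ∀ ω,
        f (s j ω) ω = ∑ r ∈ @SimpleFunc.range _ _ G (s j), (s j ⁻¹' {r}).indicator (f r) ω := by
      intro f ω
      rw [Finset.sum_eq_single_of_mem (s j ω) (@SimpleFunc.mem_range_self _ _ G (s j) ω)]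
      · simp
      · intro r _ hr; simp [Set.indicator, hr.symm]
    have h1 := hdec fun r ω => W ω * ENNReal.ofReal (Real.exp (r * ε ω - r ^ 2 / 2))
    have h2 := hdec fun _ ω => W ω
    rw [lintegral_congr h1, lintegral_congr h2, lintegral_finsetSum, lintegral_finsetSum]
    · refine Finset.sum_le_sum fun r _ => ?_
      have := hε.lintegral_mul_exp_const_le hG hm r (hW.indicator (hfib r))
      refine le_trans (le_of_eq (lintegral_congr fun ω => ?_)) this
      by_cases h : ω ∈ s j ⁻¹' {r} <;> simp [Set.indicator, h]
    · exact fun r _ => hWm.indicator (hG _ (hfib r))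
    · exact fun r _ => Measurable.indicator (by fun_prop) (hG _ (hfib r))
  have hlim : ∀ ω, W ω * ENNReal.ofReal (Real.exp (Λ ω * ε ω - Λ ω ^ 2 / 2))
      = Filter.liminf (fun j => W ω * ENNReal.ofReal (Real.exp (s j ω * ε ω - s j ω ^ 2 / 2)))
        Filter.atTop := by
    intro ω
    have hc : Continuous fun l : ℝ => ENNReal.ofReal (Real.exp (l * ε ω - l ^ 2 / 2)) :=
      ENNReal.continuous_ofReal.comp (by fun_prop)
    have ht := (hc.tendsto (Λ ω)).comp (hsm.tendsto_approx ω)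
    exact (ENNReal.Tendsto.const_mul ht (Or.inl (ENNReal.ofReal_pos.mpr (Real.exp_pos _)).ne')
      ).liminf_eq.symm
  rw [lintegral_congr hlim]
  refine (lintegral_liminf_le fun j => ?_).trans ?_
  · have := hsmeas j; fun_prop
  · exact Filter.liminf_le_of_frequently_le' (Filter.Frequently.of_forall hsimple)

/-- One step of the method of mixtures. -/
lemma CondSubgaussian.lintegral_mul_mixture_le (hε : CondSubgaussian P G ε) (hG : G ≤ mΩ)
    (hm : Measurable ε) {b u : Ω → ℝ} (hb : Measurable[G] b) (hu : Measurable[G] u)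
    (hu0 : ∀ ω, 0 ≤ u ω) {W : Ω → ℝ≥0∞} (hW : Measurable[G] W) :
    ∫⁻ ω, W ω * ENNReal.ofReal (Real.exp ((2 * b ω * ε ω + u ω * ε ω ^ 2 - b ω ^ 2)
      / (1 + u ω) / 2) / √(1 + u ω)) ∂P ≤ ∫⁻ ω, W ω ∂P := by
  have hWm : Measurable W := hW.mono hG le_rfl
  have hbm : Measurable b := hb.mono hG le_rfl
  have hum : Measurable u := hu.mono hG le_rfl
  have h1 : ∀ ω, W ω * ENNReal.ofReal (Real.exp ((2 * b ω * ε ω + u ω * ε ω ^ 2 - b ω ^ 2)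
      / (1 + u ω) / 2) / √(1 + u ω)) = ∫⁻ g, W ω * ENNReal.ofReal (Real.exp
        ((b ω + √(u ω) * g) * ε ω - (b ω + √(u ω) * g) ^ 2 / 2))
        ∂(ProbabilityTheory.gaussianReal 0 1) := by
    intro ω
    rw [lintegral_const_mul _ (by fun_prop), lintegral_exp_gaussianReal _ _ (hu0 ω)]
  rw [lintegral_congr h1, lintegral_lintegral_swap (by fun_prop)]
  calc _ ≤ ∫⁻ _g, ∫⁻ ω, W ω ∂P ∂(ProbabilityTheory.gaussianReal 0 1) :=
        lintegral_mono fun g => hε.lintegral_mul_exp_le hG hm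
          (hb.add (hu.sqrt.mul_const g)) hW
    _ = _ := by simp

end Subgaussian

/-! ### Measurability of the statistics of random data -/

section Statistics

variable {d : ℕ} {Ω : Type*} [MeasurableSpace Ω]

/-- Cramer's rule: each entry is the inverse determinant times a continuous cofactor, so singular
matrices need no separate treatment. -/
lemma measurable_matrix_inv_apply (i j : Fin d) :
    Measurable fun A : Fin d → Fin d → ℝ => (Matrix.of A)⁻¹ i j := by
  have h1 : Continuous fun A : Fin d → Fin d → ℝ => (Matrix.of A).det :=
    Continuous.matrix_det continuous_id
  have h2 : Continuous fun A : Fin d → Fin d → ℝ => (Matrix.of A).adjugate i j :=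
    (Continuous.matrix_adjugate continuous_id).matrix_elem i j
  have h3 : ∀ A : Fin d → Fin d → ℝ, (Matrix.of A)⁻¹ i j
      = ((Matrix.of A).det)⁻¹ * (Matrix.of A).adjugate i j := fun A => by
    rw [Matrix.inv_def, Ring.inverse_eq_inv', Matrix.smul_apply, smul_eq_mul]
  simp_rw [h3]
  exact h1.measurable.inv.mul h2.measurable

/-- The statistics that determine the confidence sets are measurable. -/
structure StatMeasurable (θ : Vec d) (h : Ω → Data d) : Prop where
  gram_apply : ∀ i j, Measurable fun ω => gram (h ω) i j
  noiseSum_apply : ∀ i, Measurable fun ω => noiseSum θ (h ω) i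

variable {θ : Vec d} {h : Ω → Data d}

lemma measurable_coord {x : Ω → Vec d} (hx : Measurable x) (i : Fin d) :
    Measurable fun ω => x ω i := by
  have h1 : Continuous fun v : Vec d => v i := by fun_prop
  exact h1.measurable.comp hx

lemma StatMeasurable.gram_inv_apply (hh : StatMeasurable θ h) (i j : Fin d) :
    Measurable fun ω => (gram (h ω))⁻¹ i j :=
  (measurable_matrix_inv_apply i j).comp
    (measurable_pi_lambda _ fun i => measurable_pi_lambda _ fun j => hh.gram_apply i j)

lemma StatMeasurable.det (hh : StatMeasurable θ h) : Measurable fun ω => (gram (h ω)).det := by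
  have h1 : Continuous fun A : Fin d → Fin d → ℝ => (Matrix.of A).det :=
    Continuous.matrix_det continuous_id
  exact h1.measurable.comp
    (measurable_pi_lambda _ fun i => measurable_pi_lambda _ fun j => hh.gram_apply i j)

lemma measurable_bilin {A : Ω → Matrix (Fin d) (Fin d) ℝ} {v w : Ω → Vec d}
    (hA : ∀ i j, Measurable fun ω => A ω i j) (hv : ∀ i, Measurable fun ω => v ω i)
    (hw : ∀ i, Measurable fun ω => w ω i) :
    Measurable fun ω => (v ω).ofLp ⬝ᵥ (A ω *ᵥ (w ω).ofLp) := by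
  simp only [dotProduct, Matrix.mulVec]
  exact Finset.measurable_sum _ fun i _ => (hv i).mul
    (Finset.measurable_sum _ fun j _ => (hA i j).mul (hw j))

lemma StatMeasurable.quadSq_inv (hh : StatMeasurable θ h) {x : Ω → Vec d} (hx : Measurable x) :
    Measurable fun ω => quadSq (gram (h ω))⁻¹ (x ω) :=
  measurable_bilin hh.gram_inv_apply (measurable_coord hx) (measurable_coord hx)

lemma lsq_sub_eq_mulVec (θ : Vec d) (h : Data d) :
    (lsq h - θ).ofLp = (gram h)⁻¹ *ᵥ (noiseSum θ h - θ).ofLp := by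
  rw [← gram_mulVec_lsq_sub, inv_mulVec_mulVec (gram_posDef h)]

/-- Expresses the error through `gram` and `noiseSum`, the two statistics whose measurability is
tracked. -/
lemma quadSq_lsq_sub (θ : Vec d) (h : Data d) :
    quadSq (gram h) (lsq h - θ) = quadSq (gram h)⁻¹ (noiseSum θ h - θ) := by
  rw [quadSq, gram_mulVec_lsq_sub, lsq_sub_eq_mulVec, dotProduct_comm, quadSq]

lemma StatMeasurable.error (hh : StatMeasurable θ h) :
    Measurable fun ω => quadSq (gram (h ω)) (lsq (h ω) - θ) := by
  simp_rw [quadSq_lsq_sub]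
  have h1 : ∀ i, Measurable fun ω => (noiseSum θ (h ω) - θ) i := fun i =>
    (hh.noiseSum_apply i).sub_const (θ i)
  exact measurable_bilin hh.gram_inv_apply h1 h1

lemma StatMeasurable.const (θ : Vec d) (h : Data d) : StatMeasurable θ fun _ : Ω => h :=
  ⟨fun _ _ => measurable_const, fun _ => measurable_const⟩

lemma StatMeasurable.cons (hh : StatMeasurable θ h) {x : Ω → Vec d} (hx : Measurable x)
    {y : Ω → ℝ} (hy : Measurable y) :
    StatMeasurable θ fun ω => (x ω, ⟪x ω, θ⟫ + y ω) :: h ω where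
  gram_apply i j := by
    simp only [gram_cons, Matrix.add_apply, Matrix.vecMulVec_apply]
    exact (hh.gram_apply i j).add ((measurable_coord hx i).mul (measurable_coord hx j))
  noiseSum_apply i := by
    simp only [noiseSum_cons, add_sub_cancel_left, PiLp.add_apply, PiLp.smul_apply, smul_eq_mul]
    exact (hh.noiseSum_apply i).add (hy.mul (measurable_coord hx i))

open Classical in
lemma StatMeasurable.ite (hh : StatMeasurable θ h) {h' : Ω → Data d} (hh' : StatMeasurable θ h')
    {A : Set Ω} (hA : MeasurableSet A) :
    StatMeasurable θ fun ω => if ω ∈ A then h' ω else h ω where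
  gram_apply i j := by
    have e : (fun ω => gram (if ω ∈ A then h' ω else h ω) i j)
        = fun ω => if ω ∈ A then gram (h' ω) i j else gram (h ω) i j := by
      funext ω; split_ifs <;> rfl
    rw [e]
    exact Measurable.ite hA (hh'.gram_apply i j) (hh.gram_apply i j)
  noiseSum_apply i := by
    have e : (fun ω => noiseSum θ (if ω ∈ A then h' ω else h ω) i)
        = fun ω => if ω ∈ A then noiseSum θ (h' ω) i else noiseSum θ (h ω) i := by
      funext ω; split_ifs <;> rfl
    rw [e]
    exact Measurable.ite hA (hh'.noiseSum_apply i) (hh.noiseSum_apply i)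

end Statistics

lemma StatMeasurable.mono {d : ℕ} {Ω : Type*} {θ : Vec d} {h : Ω → Data d} {m₁ m₂ : MeasurableSpace Ω} (hm : m₁ ≤ m₂)
    (hh : @StatMeasurable d Ω m₁ θ h) : @StatMeasurable d Ω m₂ θ h :=
  @StatMeasurable.mk d Ω m₂ θ h
    (fun i j => (@StatMeasurable.gram_apply d Ω m₁ θ h hh i j).mono hm le_rfl)
    fun i => (@StatMeasurable.noiseSum_apply d Ω m₁ θ h hh i).mono hm le_rfl

/-! ### Self-normalized evidence against the true parameter -/

section Evidence

variable {d : ℕ}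

/-- The self-normalized mixture martingale `exp(½‖S‖²_{V⁻¹}) / √(det V)`. -/
def evidence (θ : Vec d) (h : Data d) : ℝ :=
  Real.exp (quadSq (gram h)⁻¹ (noiseSum θ h) / 2) / √(gram h).det

lemma evidence_nonneg (θ : Vec d) (h : Data d) : 0 ≤ evidence θ h := by
  unfold evidence; positivity

lemma evidence_nil (θ : Vec d) : evidence θ [] = 1 := by
  simp [evidence, noiseSum_nil, gram_nil, quadSq]

/-- The new factor is the value of the integral in `lintegral_exp_gaussianReal` at `b = ⟨x, V⁻¹ S⟩`,
`u = ‖x‖²_{V⁻¹}`. Thus the `d`-dimensional mixture is handled by one-dimensional ones, step by step.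
-/
lemma evidence_cons (θ : Vec d) (h : Data d) (x : Vec d) (e : ℝ) :
    evidence θ ((x, ⟪x, θ⟫ + e) :: h) = evidence θ h *
      (Real.exp ((2 * (x.ofLp ⬝ᵥ ((gram h)⁻¹ *ᵥ (noiseSum θ h).ofLp)) * e
        + quadSq (gram h)⁻¹ x * e ^ 2
        - (x.ofLp ⬝ᵥ ((gram h)⁻¹ *ᵥ (noiseSum θ h).ofLp)) ^ 2) / (1 + quadSq (gram h)⁻¹ x) / 2)
        / √(1 + quadSq (gram h)⁻¹ x)) := by
  have hd : 0 ≤ (gram h).det := zero_le_one.trans (one_le_det_gram h)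
  rw [evidence, evidence, noiseSum_cons, det_gram_cons, gram_cons]
  simp only [add_sub_cancel_left]
  rw [quadSq_inv_add_vecMulVec_self (gram_posDef h), Real.sqrt_mul hd, add_div, Real.exp_add]
  rw [div_mul_div_comm]

/-- Outside the confidence set the evidence is large. -/
lemma le_evidence {θ : Vec d} (hθ : ‖θ‖ ≤ 1) (h : Data d) {r : ℝ} (hr : 1 ≤ r)
    (hbad : sqrtBeta h r ≤ √(quadSq (gram h) (lsq h - θ))) : r ≤ evidence θ h := by
  have h1 := hbad.trans (sqrt_quadSq_lsq_sub_le hθ h)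
  rw [sqrtBeta, add_le_add_iff_right] at h1
  rw [Real.sqrt_le_sqrt_iff (gram_inv_nonneg h _)] at h1
  have hd : 0 < (gram h).det := one_pos.trans_le (one_le_det_gram h)
  have hr0 : 0 < r := by linarith
  rw [evidence, le_div_iff₀ (Real.sqrt_pos.mpr hd)]
  have h2 : r * √(gram h).det = Real.exp (Real.log r + Real.log (gram h).det / 2) := by
    rw [Real.exp_add, Real.exp_log hr0, ← Real.log_sqrt hd.le, Real.exp_log (Real.sqrt_pos.mpr hd)]
  rw [h2]
  exact Real.exp_le_exp.mpr (by linarith)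

variable {Ω : Type*}

lemma StatMeasurable.evidence [MeasurableSpace Ω] {θ : Vec d} {h : Ω → Data d}
    (hh : StatMeasurable θ h) : Measurable fun ω => evidence θ (h ω) := by
  have h1 : Measurable fun ω => quadSq (gram (h ω))⁻¹ (noiseSum θ (h ω)) :=
    measurable_bilin hh.gram_inv_apply hh.noiseSum_apply hh.noiseSum_apply
  have h2 := hh.det
  unfold LinBandit.evidence
  fun_prop

open Classical in
/-- Data collected when the observation of round `t + 1` is recorded on the event `A t`. -/
def collect (A : ℕ → Set Ω) (θ : Vec d) (x : ℕ → Ω → Vec d) (ε : ℕ → Ω → ℝ) : ℕ → Ω → Data d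
  | 0, _ => []
  | t + 1, ω =>
    if ω ∈ A t then (x (t + 1) ω, ⟪x (t + 1) ω, θ⟫ + ε (t + 1) ω) :: collect A θ x ε t ω
    else collect A θ x ε t ω

variable {mΩ : MeasurableSpace Ω} {P : Measure Ω} {ℱ : Filtration ℕ mΩ} {A : ℕ → Set Ω}
  {θ : Vec d} {x : ℕ → Ω → Vec d} {ε : ℕ → Ω → ℝ}

lemma statMeasurable_collect (hA : ∀ t, MeasurableSet[ℱ t] (A t))
    (hx : ∀ t, Measurable[ℱ (t + 1)] (x (t + 1))) (hε : ∀ t, Measurable[ℱ (t + 1)] (ε (t + 1)))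
    (t : ℕ) : @StatMeasurable d Ω (ℱ t) θ (collect A θ x ε t) := by
  induction t with
  | zero => exact @StatMeasurable.const d Ω (ℱ 0) θ []
  | succ t ih =>
    have hle := ℱ.mono t.le_succ
    have ih' : @StatMeasurable d Ω (ℱ (t + 1)) θ (collect A θ x ε t) := ih.mono hle
    exact @StatMeasurable.ite d Ω (ℱ (t + 1)) θ _ ih' _
      (@StatMeasurable.cons d Ω (ℱ (t + 1)) θ _ ih' _ (hx t) _ (hε t)) _ (hle _ (hA t))

open Classical in
-- One supermartingale step. `G` already contains the action, so `A`, `b` and `u` are known and only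
-- the noise is averaged; off `A` nothing changes.
lemma lintegral_evidence_ite_le {Ω : Type*} {G mΩ : MeasurableSpace Ω} {P : Measure Ω}
    [IsProbabilityMeasure P] (hG : G ≤ mΩ) {A : Set Ω} (hA : MeasurableSet[G] A)
    {x : Ω → Vec d} (hx : Measurable[G] x) {e : Ω → ℝ} (he : Measurable e)
    (hsub : CondSubgaussian P G e) {H : Ω → Data d} (hst : @StatMeasurable d Ω G θ H) :
    ∫⁻ ω, ENNReal.ofReal (evidence θ
        (if ω ∈ A then (x ω, ⟪x ω, θ⟫ + e ω) :: H ω else H ω)) ∂P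
      ≤ ∫⁻ ω, ENNReal.ofReal (evidence θ (H ω)) ∂P := by
  have hAm : MeasurableSet A := hG _ hA
  set b : Ω → ℝ := fun ω => (x ω).ofLp ⬝ᵥ ((gram (H ω))⁻¹ *ᵥ (noiseSum θ (H ω)).ofLp) with hb
  set u : Ω → ℝ := fun ω => quadSq (gram (H ω))⁻¹ (x ω) with hu
  have hbm : Measurable[G] b := @measurable_bilin d Ω G _ _ _
    (@StatMeasurable.gram_inv_apply d Ω G θ H hst) (@measurable_coord d Ω G _ hx)
    (@StatMeasurable.noiseSum_apply d Ω G θ H hst)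
  have hum : Measurable[G] u := @StatMeasurable.quadSq_inv d Ω G θ H hst _ hx
  have hEv : Measurable[G] fun ω => ENNReal.ofReal (evidence θ (H ω)) :=
    (@StatMeasurable.evidence d Ω G θ H hst).ennreal_ofReal
  set W : Ω → ℝ≥0∞ := A.indicator fun ω => ENNReal.ofReal (evidence θ (H ω)) with hW
  have hWm : Measurable[G] W := hEv.indicator hA
  have hstep := hsub.lintegral_mul_mixture_le hG he hbm hum (fun ω => gram_inv_nonneg _ _) hWm
  have hc : Measurable (Aᶜ.indicator fun ω => ENNReal.ofReal (evidence θ (H ω))) :=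
    (hEv.mono hG le_rfl).indicator hAm.compl
  have h1 : ∀ ω, ENNReal.ofReal (evidence θ
        (if ω ∈ A then (x ω, ⟪x ω, θ⟫ + e ω) :: H ω else H ω))
      = Aᶜ.indicator (fun ω => ENNReal.ofReal (evidence θ (H ω))) ω
        + W ω * ENNReal.ofReal (Real.exp ((2 * b ω * e ω + u ω * e ω ^ 2 - b ω ^ 2)
          / (1 + u ω) / 2) / √(1 + u ω)) := by
    intro ω
    by_cases hω : ω ∈ A
    · simp only [hω, if_true, hW, Set.indicator, Set.mem_compl_iff, not_true, if_false, zero_add]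
      rw [evidence_cons, ENNReal.ofReal_mul (evidence_nonneg _ _)]
    · simp [hω, hW, Set.indicator]
  have h2 : ∀ ω, ENNReal.ofReal (evidence θ (H ω))
      = Aᶜ.indicator (fun ω => ENNReal.ofReal (evidence θ (H ω))) ω + W ω := by
    intro ω
    rw [add_comm, hW, Set.indicator_self_add_compl_apply]
  rw [lintegral_congr h1, lintegral_congr h2, lintegral_add_left hc, lintegral_add_left hc]
  exact add_le_add le_rfl hstep

/-- The mean evidence against the true parameter never exceeds `1`. -/
lemma lintegral_evidence_collect_le [IsProbabilityMeasure P]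
    (hA : ∀ t, MeasurableSet[ℱ t] (A t))
    (hx : ∀ t, Measurable[ℱ (t + 1)] (x (t + 1))) (hε : ∀ t, Measurable[ℱ (t + 1)] (ε (t + 1)))
    (hsub : ∀ t, CondSubgaussian P
      (ℱ t ⊔ MeasurableSpace.comap (x (t + 1)) inferInstance) (ε (t + 1))) (t : ℕ) :
    ∫⁻ ω, ENNReal.ofReal (evidence θ (collect A θ x ε t ω)) ∂P ≤ 1 := by
  induction t with
  | zero => simp [collect, evidence_nil]
  | succ t ih =>
    refine le_trans ?_ ih
    exact lintegral_evidence_ite_le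
      (sup_le (ℱ.le t) (((hx t).mono (ℱ.le (t + 1)) le_rfl).comap_le))
      ((le_sup_left : ℱ t ≤ _) _ (hA t))
      ((comap_measurable (x (t + 1))).mono le_sup_right le_rfl)
      ((hε t).mono (ℱ.le (t + 1)) le_rfl) (hsub t)
      ((statMeasurable_collect (θ := θ) hA hx hε t).mono le_sup_left)

end Evidence

/-! ### Pathwise bounds along the collected data -/

section Pathwise

variable {d : ℕ} {Ω : Type*} {A : ℕ → Set Ω} {θ : Vec d} {x : ℕ → Ω → Vec d} {ε : ℕ → Ω → ℝ}

lemma collect_succ_of_mem {t : ℕ} {ω : Ω} (h : ω ∈ A t) :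
    collect A θ x ε (t + 1) ω
      = (x (t + 1) ω, ⟪x (t + 1) ω, θ⟫ + ε (t + 1) ω) :: collect A θ x ε t ω := by
  simp [collect, h]

lemma collect_succ_of_notMem {t : ℕ} {ω : Ω} (h : ω ∉ A t) :
    collect A θ x ε (t + 1) ω = collect A θ x ε t ω := by
  simp [collect, h]

lemma length_collect_le (t : ℕ) (ω : Ω) : (collect A θ x ε t ω).length ≤ t := by
  induction t with
  | zero => simp [collect]
  | succ t ih =>
    by_cases h : ω ∈ A t
    · rw [collect_succ_of_mem h, List.length_cons]; omega
    · rw [collect_succ_of_notMem h]; omega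

lemma forall_mem_collect {p : Vec d → Prop} (hp : ∀ t ω, p (x (t + 1) ω)) (t : ℕ) (ω : Ω) :
    ∀ q ∈ collect A θ x ε t ω, p q.1 := by
  induction t with
  | zero => simp [collect]
  | succ t ih =>
    by_cases h : ω ∈ A t
    · rw [collect_succ_of_mem h]
      intro q hq
      rcases List.mem_cons.mp hq with rfl | hq
      · exact hp t ω
      · exact ih q hq
    · rwa [collect_succ_of_notMem h]

/-- Data grow only in recorded rounds, so a proper suffix was the current data in some recorded
round. This makes information about earlier rounds available for every `m_l`, `l ≤ s`. -/
lemma eq_or_exists_of_suffix_collect {h : Data d} {t : ℕ} {ω : Ω}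
    (hs : h <:+ collect A θ x ε t ω) :
    h = collect A θ x ε t ω ∨ ∃ i < t, h = collect A θ x ε i ω ∧ ω ∈ A i := by
  induction t with
  | zero =>
    left
    simpa [collect] using hs
  | succ t ih =>
    by_cases hA : ω ∈ A t
    · rw [collect_succ_of_mem hA] at hs ⊢
      rcases List.suffix_cons_iff.mp hs with he | hs
      · exact Or.inl he
      · right
        rcases ih hs with he | ⟨i, hi, he, hiA⟩
        · exact ⟨t, t.lt_succ_self, he, hA⟩
        · exact ⟨i, hi.trans t.lt_succ_self, he, hiA⟩
    · rw [collect_succ_of_notMem hA] at hs ⊢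
      rcases ih hs with he | ⟨i, hi, he, hiA⟩
      · exact Or.inl he
      · exact Or.inr ⟨i, hi.trans t.lt_succ_self, he, hiA⟩

lemma le_mul_log_one_add {u K : ℝ} (hu : 0 ≤ u) (hK : u ≤ K) : u ≤ (1 + K) * Real.log (1 + u) := by
  have h1 : 0 < 1 + u := by linarith
  have h2 := Real.one_sub_inv_le_log_of_pos h1
  have h3 : 1 - (1 + u)⁻¹ = u / (1 + u) := by field_simp; ring
  rw [h3] at h2
  calc u = (1 + u) * (u / (1 + u)) := by field_simp
    _ ≤ (1 + K) * (u / (1 + u)) := by gcongr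
    _ ≤ _ := by gcongr; linarith

/-- Elliptical potential lemma. -/
lemma sum_indicator_quadSq_le {L : ℝ} (hx : ∀ t ω, ‖x (t + 1) ω‖ ≤ L) (n : ℕ) (ω : Ω) :
    ∑ t ∈ Finset.range n, (A t).indicator
        (fun ω => quadSq (gram (collect A θ x ε t ω))⁻¹ (x (t + 1) ω)) ω
      ≤ (1 + L ^ 2) * Real.log (gram (collect A θ x ε n ω)).det := by
  induction n with
  | zero => simp [collect, gram_nil]
  | succ n ih =>
    rw [Finset.sum_range_succ]
    by_cases hA : ω ∈ A n
    · rw [collect_succ_of_mem hA, det_gram_cons, Set.indicator_of_mem hA]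
      set u := quadSq (gram (collect A θ x ε n ω))⁻¹ (x (n + 1) ω) with hu
      have hu0 : 0 ≤ u := gram_inv_nonneg _ _
      have hd := one_le_det_gram (collect A θ x ε n ω)
      rw [Real.log_mul (by positivity) (by positivity), mul_add]
      refine add_le_add ih (le_mul_log_one_add hu0 ?_)
      refine (quadSq_gram_inv_le _ _).trans ?_
      have := hx n ω
      gcongr
    · rw [collect_succ_of_notMem hA, Set.indicator_of_notMem hA, add_zero]
      exact ih

lemma log_det_gram_le {L : ℝ} {n : ℕ} (h : Data d) (hL : ∀ p ∈ h, ‖p.1‖ ≤ L)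
    (hn : h.length ≤ n) : Real.log (gram h).det ≤ d * Real.log (1 + n * L ^ 2) := by
  rw [← Real.log_pow]
  refine Real.log_le_log (one_pos.trans_le (one_le_det_gram h)) ((det_gram_le h hL).trans ?_)
  have : (h.length : ℝ) ≤ n := by exact_mod_cast hn
  gcongr

lemma sqrtBeta_le {L : ℝ} {n : ℕ} (h : Data d) (hL : ∀ p ∈ h, ‖p.1‖ ≤ L)
    (hn : h.length ≤ n) {r : ℝ} (hr : 1 ≤ r) (hrn : r ≤ (n : ℝ) ^ 2) :
    sqrtBeta h r ≤ √(4 * Real.log n + d * Real.log (1 + n * L ^ 2)) + 1 := by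
  have h1 := log_det_gram_le h hL hn
  have h2 : Real.log r ≤ 2 * Real.log n := by
    have := Real.log_le_log (by linarith) hrn
    rwa [Real.log_pow] at this
  rw [sqrtBeta]
  exact add_le_add (Real.sqrt_le_sqrt (by linarith)) le_rfl

variable (A θ x ε) in
/-- The event `A t` restricted to at most `k` observations. -/
def frozenSet (k t : ℕ) : Set Ω := A t ∩ {ω | (collect A θ x ε t ω).length < k}

/-- The data frozen as soon as `k` observations are available. -/
lemma collect_frozen_eq {k t : ℕ} {ω : Ω} (h : (collect A θ x ε t ω).length ≤ k) :
    collect (frozenSet A θ x ε k) θ x ε t ω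
      = collect A θ x ε t ω := by
  induction t with
  | zero => rfl
  | succ t ih =>
    by_cases hA : ω ∈ A t
    · have h' := h
      rw [collect_succ_of_mem hA, List.length_cons] at h'
      have hA' : ω ∈ frozenSet A θ x ε k t := ⟨hA, h'⟩
      rw [collect_succ_of_mem hA, collect_succ_of_mem (A := frozenSet A θ x ε k) hA', ih (by omega)]
    · have hA' : ω ∉ frozenSet A θ x ε k t := fun h => hA h.1
      rw [collect_succ_of_notMem hA] at h ⊢
      rw [collect_succ_of_notMem (A := frozenSet A θ x ε k) hA', ih h]

/-- A weight that is paid in a round with `k` observations is paid once, and is bounded in terms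
of the data frozen at `k` observations. -/
lemma sum_indicator_length_eq_le {w : Data d → ℝ} (f : Data d → ℝ) (hf : ∀ h, 0 ≤ f h)
    (hw : ∀ h, w h ≤ f h) (k n : ℕ) (ω : Ω) :
    ∑ t ∈ Finset.range n, (A t ∩ {ω | (collect A θ x ε t ω).length = k}).indicator
        (fun ω => w (collect A θ x ε t ω)) ω
      ≤ f (collect (frozenSet A θ x ε k) θ x ε n ω) := by
  classical
  -- Strengthened for the induction: nothing is paid until observation `k + 1` is recorded, and from
  -- then on the frozen data no longer change.
  suffices h : ∑ t ∈ Finset.range n, (A t ∩ {ω | (collect A θ x ε t ω).length = k}).indicator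
        (fun ω => w (collect A θ x ε t ω)) ω
      ≤ if k < (collect A θ x ε n ω).length then
        f (collect (frozenSet A θ x ε k) θ x ε n ω) else 0 by
    refine h.trans ?_
    split_ifs
    · exact le_rfl
    · exact hf _
  induction n with
  | zero => simp [collect]
  | succ n ih =>
    rw [Finset.sum_range_succ]
    by_cases hk : k < (collect A θ x ε n ω).length
    · have h1 : ω ∉ A n ∩ {ω | (collect A θ x ε n ω).length = k} := fun h => hk.ne' h.2
      have h2 : ω ∉ frozenSet A θ x ε k n := fun h =>
        hk.not_gt h.2
      rw [if_pos hk] at ih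
      have h3 : k < (collect A θ x ε (n + 1) ω).length := by
        by_cases hA : ω ∈ A n
        · rw [collect_succ_of_mem hA, List.length_cons]; omega
        · rwa [collect_succ_of_notMem hA]
      rw [if_pos h3, Set.indicator_of_notMem h1, add_zero,
        collect_succ_of_notMem (A := frozenSet A θ x ε k) h2]
      exact ih
    · rw [if_neg hk] at ih
      by_cases hA : ω ∈ A n ∩ {ω | (collect A θ x ε n ω).length = k}
      · have h3 : k < (collect A θ x ε (n + 1) ω).length := by
          rw [collect_succ_of_mem hA.1, List.length_cons, hA.2]; omega
        have h2 : ω ∉ frozenSet A θ x ε k n := fun h => (show _ < k from h.2).ne hA.2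
        rw [if_pos h3, Set.indicator_of_mem hA, collect_succ_of_notMem (A := frozenSet A θ x ε k) h2,
          collect_frozen_eq hA.2.le]
        linarith [hw (collect A θ x ε n ω)]
      · rw [Set.indicator_of_notMem hA, add_zero]
        refine ih.trans ?_
        split_ifs
        · exact hf _
        · exact le_rfl

variable {mΩ : MeasurableSpace Ω} {ℱ : Filtration ℕ mΩ}

lemma measurable_length_collect (hA : ∀ t, MeasurableSet[ℱ t] (A t)) (t : ℕ) :
    Measurable[ℱ t] fun ω => (collect A θ x ε t ω).length := by
  classical
  induction t with
  | zero => exact measurable_const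
  | succ t ih =>
    have hle := ℱ.mono t.le_succ
    have e : (fun ω => (collect A θ x ε (t + 1) ω).length)
        = fun ω => if ω ∈ A t then (collect A θ x ε t ω).length + 1
          else (collect A θ x ε t ω).length := by
      funext ω
      by_cases h : ω ∈ A t <;> simp [collect, h]
    rw [e]
    have ih' := ih.mono hle le_rfl
    exact Measurable.ite (hle _ (hA t)) (ih'.add_const 1) ih'

lemma measurableSet_frozenSet (hA : ∀ t, MeasurableSet[ℱ t] (A t)) (k t : ℕ) :
    MeasurableSet[ℱ t] (frozenSet A θ x ε k t) :=
  (hA t).inter (measurable_length_collect hA t measurableSet_Iio)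

end Pathwise

/-! ### Regret of a run -/

section Run

variable {d : ℕ} {Ω : Type*} {mΩ : MeasurableSpace Ω} {P : Measure Ω} {ℱ : Filtration ℕ mΩ}
  {X : Finset (Vec d)} {M : Set (Vec d)} {c : Choices d} {θ : Vec d}
  {x : ℕ → Ω → Vec d} {ε : ℕ → Ω → ℝ}

variable (X M c θ x ε) in
/-- The event that round `t + 1` is an exploration round. -/
def exploreSet (t : ℕ) : Set Ω :=
  {ω | ¬ Exploit X M c (dataAt X M c θ (fun i => x i ω) (fun i => ε i ω) t) (t + 1)}

variable (X M c θ x ε) in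
/-- The data available after `t` rounds, as a random variable. -/
def history : ℕ → Ω → Data d := collect (exploreSet X M c θ x ε) θ x ε

lemma dataAt_eq_history (t : ℕ) (ω : Ω) :
    dataAt X M c θ (fun i => x i ω) (fun i => ε i ω) t = history X M c θ x ε t ω := by
  induction t with
  | zero => rfl
  | succ t ih =>
    rw [history] at ih ⊢
    by_cases h : ω ∈ exploreSet X M c θ x ε t
    · rw [collect_succ_of_mem h, dataAt, if_neg h, ih]
    · rw [collect_succ_of_notMem h, dataAt, if_pos (not_not.mp h), ih]

lemma mem_exploreSet {t : ℕ} {ω : Ω} :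
    ω ∈ exploreSet X M c θ x ε t ↔ ¬ Exploit X M c (history X M c θ x ε t ω) (t + 1) := by
  rw [exploreSet, ← dataAt_eq_history]; rfl

lemma measurableSet_exploreSet (hrun : IsRun P ℱ X M c θ x ε) (t : ℕ) :
    MeasurableSet[ℱ t] (exploreSet X M c θ x ε t) :=
  (hrun.exploit_meas t).compl

lemma statMeasurable_history (hrun : IsRun P ℱ X M c θ x ε) (t : ℕ) :
    @StatMeasurable d Ω (ℱ t) θ (history X M c θ x ε t) :=
  statMeasurable_collect (measurableSet_exploreSet hrun) hrun.action_meas hrun.noise_meas t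

lemma IsRun.condSubgaussian (hrun : IsRun P ℱ X M c θ x ε) (t : ℕ) :
    CondSubgaussian P (ℱ t ⊔ MeasurableSpace.comap (x (t + 1)) inferInstance) (ε (t + 1)) :=
  fun r => ⟨hrun.noise_integrable t r, hrun.noise_subgaussian t r⟩

/-- The mean evidence against the true parameter in selected observations is at most `1`. -/
lemma integral_evidence_le [IsProbabilityMeasure P] (hrun : IsRun P ℱ X M c θ x ε)
    {A : ℕ → Set Ω} (hA : ∀ t, MeasurableSet[ℱ t] (A t)) (t : ℕ) :
    Integrable (fun ω => evidence θ (collect A θ x ε t ω)) P ∧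
      ∫ ω, evidence θ (collect A θ x ε t ω) ∂P ≤ 1 := by
  have h1 := lintegral_evidence_collect_le (P := P) (θ := θ) hA hrun.action_meas hrun.noise_meas
    hrun.condSubgaussian t
  have hm : Measurable fun ω => evidence θ (collect A θ x ε t ω) :=
    (statMeasurable_collect hA hrun.action_meas hrun.noise_meas t).mono (ℱ.le t) |>.evidence
  have h0 : ∀ ω, 0 ≤ evidence θ (collect A θ x ε t ω) := fun ω => evidence_nonneg _ _
  refine ⟨⟨hm.aestronglyMeasurable, ?_⟩, ?_⟩
  · rw [hasFiniteIntegral_iff_ofReal (ae_of_all _ h0)]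
    exact h1.trans_lt ENNReal.one_lt_top
  · rw [integral_eq_lintegral_of_nonneg_ae (ae_of_all _ h0) hm.aestronglyMeasurable]
    exact ENNReal.toReal_le_of_le_ofReal zero_le_one (by simpa using h1)

/-- Replacing the action by its conditional law. -/
lemma integral_action_eq [IsProbabilityMeasure P] (hrun : IsRun P ℱ X M c θ x ε) (t : ℕ)
    {f : Vec d → Ω → ℝ} (hf : ∀ a ∈ X, Measurable[ℱ t] (f a)) {K : ℝ}
    (hK : ∀ a ∈ X, ∀ ω, |f a ω| ≤ K) :
    Integrable (fun ω => f (x (t + 1) ω) ω) P ∧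
    Integrable (fun ω => ∑ a ∈ X,
      f a ω * actionProb X M c (history X M c θ x ε t ω) (t + 1) a) P ∧
    ∫ ω, f (x (t + 1) ω) ω ∂P
      = ∫ ω, ∑ a ∈ X, f a ω * actionProb X M c (history X M c θ x ε t ω) (t + 1) a ∂P := by
  classical
  have hxm : Measurable (x (t + 1)) := (hrun.action_meas t).mono (ℱ.le _) le_rfl
  set ind : Vec d → Ω → ℝ := fun a => (x (t + 1) ⁻¹' {a}).indicator (fun _ => (1 : ℝ)) with hind
  have hindi : ∀ a, Integrable (ind a) P := fun a =>
    (integrable_const (1 : ℝ)).indicator (hxm (measurableSet_singleton a))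
  have hfm : ∀ a ∈ X, Measurable (f a) := fun a ha => (hf a ha).mono (ℱ.le t) le_rfl
  have hbd : ∀ a ∈ X, ∀ g : Ω → ℝ, Integrable g P → Integrable (fun ω => f a ω * g ω) P :=
    fun a ha g hg => hg.bdd_mul (c := K) (hfm a ha).aestronglyMeasurable
      (ae_of_all _ fun ω => by rw [Real.norm_eq_abs]; exact hK a ha ω)
  have hlaw : ∀ a ∈ X, P[ind a | ℱ t] =ᵐ[P]
      fun ω => actionProb X M c (history X M c θ x ε t ω) (t + 1) a := fun a ha => by
    have := hrun.action_law t a ha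
    simpa only [dataAt_eq_history] using this
  have hpi : ∀ a ∈ X, Integrable
      (fun ω => f a ω * actionProb X M c (history X M c θ x ε t ω) (t + 1) a) P := fun a ha =>
    hbd a ha _ (integrable_condExp.congr (hlaw a ha))
  have hsum : ∀ ω, f (x (t + 1) ω) ω = ∑ a ∈ X, f a ω * ind a ω := by
    intro ω
    rw [Finset.sum_eq_single_of_mem (x (t + 1) ω) (hrun.action_mem t ω)]
    · simp [hind]
    · intro a _ ha; simp [hind, ha.symm]
  have heq : ∀ a ∈ X, ∫ ω, f a ω * ind a ω ∂P
      = ∫ ω, f a ω * actionProb X M c (history X M c θ x ε t ω) (t + 1) a ∂P := by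
    intro a ha
    have h1 := condExp_mul_of_stronglyMeasurable_left (m := ℱ t) (μ := P)
      (hf a ha).stronglyMeasurable (hbd a ha _ (hindi a)) (hindi a)
    have h2 := integral_condExp (ℱ.le t) (μ := P) (f := f a * ind a)
    rw [← show ∫ ω, (f a * ind a) ω ∂P = ∫ ω, f a ω * ind a ω ∂P from rfl, ← h2]
    refine integral_congr_ae (h1.trans ?_)
    filter_upwards [hlaw a ha] with ω hω
    rw [Pi.mul_apply, hω]
  refine ⟨?_, integrable_finsetSum _ hpi, ?_⟩
  · simp_rw [hsum]
    exact integrable_finsetSum _ fun a ha => hbd a ha _ (hindi a)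
  · simp_rw [hsum]
    rw [integral_finsetSum _ fun a ha => hbd a ha _ (hindi a), integral_finsetSum _ hpi]
    exact Finset.sum_congr rfl heq

/-- An exploitation round with a suboptimal action needs evidence against the true parameter. -/
lemma le_evidence_of_exploit {xstar : Vec d} (hθ : ‖θ‖ ≤ 1) (hθM : θ ∈ M) (hc : IsIDS X M c)
    (hs : xstar ∈ X) (hopt : ∀ a ∈ X, ⟪a, θ⟫ ≤ ⟪xstar, θ⟫) {h : Data d} {t : ℕ}
    (hex : Exploit X M c h t) (hne : c.xhat h ≠ xstar) :
    max 1 (t * Real.log t) ≤ evidence θ h := by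
  refine le_evidence hθ h (le_max_left _ _) ?_
  -- `θ` competes in the minimum that defines `ν̂(xstar)`, so `m_s ≤ ½‖θ - θ̂‖²_V`; the exploitation
  -- test then bounds the error from below.
  have hθH : θ ∈ halfspace M (c.xhat h) xstar := by
    refine ⟨hθM, ?_⟩
    rw [inner_sub_left]
    linarith [hopt _ (hc.xhat_mem h)]
  have hmem : xstar ∈ alts X M c h := mem_alts.mpr ⟨hs, hne.symm, θ, hθH⟩
  have h1 : minAlt X M c h ≤ ENNReal.ofReal (altSq c h xstar / 2) := iInf₂_le _ hmem
  have h2 := hc.nu_min h xstar hmem θ hθH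
  have h3 := (ENNReal.ofReal_le_ofReal_iff (by linarith [altSq_nonneg c h xstar])).mp
    (le_trans hex h1)
  have h4 : quadSq (gram h) (θ - lsq h) = quadSq (gram h) (lsq h - θ) := by
    have := quadSq_smul (gram h) (-1) (lsq h - θ)
    simpa using this
  refine Real.le_sqrt_of_sq_le ?_
  rw [← h4]; linarith

end Run

/-! ### Uniform bounds on confidence coefficients and the miss event -/

section HistoryBounds

variable {d : ℕ} {Ω : Type*} {mΩ : MeasurableSpace Ω} {P : Measure Ω}
  {ℱ : Filtration ℕ mΩ} {X : Finset (Vec d)} {M : Set (Vec d)} {c : Choices d}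
  {θ : Vec d} {x : ℕ → Ω → Vec d} {ε : ℕ → Ω → ℝ}

/-- The confidence coefficients of the first `n` rounds are at most `confBound d L n`. -/
def confBound (d : ℕ) (L : ℝ) (n : ℕ) : ℝ :=
  (√(4 * Real.log n + d * Real.log (1 + n * L ^ 2)) + 1) ^ 2

lemma one_le_confBound (d : ℕ) (L : ℝ) (n : ℕ) : 1 ≤ confBound d L n := by
  have := Real.sqrt_nonneg (4 * Real.log n + d * Real.log (1 + n * L ^ 2))
  rw [confBound]; nlinarith

variable {L : ℝ}

/-- The range `r ≤ n²` covers both coefficients of the algorithm, `s²` and `max(1, t log t)`. -/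
lemma sq_sqrtBeta_history_le (hrun : IsRun P ℱ X M c θ x ε) (hL : ∀ a ∈ X, ‖a‖ ≤ L) {t n : ℕ}
    (ht : t ≤ n) {r : ℝ} (hr : 1 ≤ r) (hrn : r ≤ (n : ℝ) ^ 2) (ω : Ω) :
    sqrtBeta (history X M c θ x ε t ω) r ^ 2 ≤ confBound d L n := by
  refine pow_le_pow_left₀ (zero_le_one.trans (one_le_sqrtBeta _ _)) (sqrtBeta_le _ ?_ ?_ hr hrn) 2
  · exact forall_mem_collect (p := fun v => ‖v‖ ≤ L) (fun t ω => hL _ (hrun.action_mem t ω)) t ω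
  · exact (length_collect_le t ω).trans ht

lemma sq_radius_history_le (hrun : IsRun P ℱ X M c θ x ε) (hL : ∀ a ∈ X, ‖a‖ ≤ L) {t n : ℕ}
    (ht : t < n) (ω : Ω) : radius (history X M c θ x ε t ω) ^ 2 ≤ confBound d L n := by
  have h1 : (1 : ℝ) ≤ (localTime (history X M c θ x ε t ω) : ℝ) := by simp [localTime]
  refine sq_sqrtBeta_history_le hrun hL ht.le (one_le_pow₀ h1) ?_ ω
  have h2 : localTime (history X M c θ x ε t ω) ≤ n :=
    (Nat.succ_le_succ (length_collect_le t ω)).trans ht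
  have h3 : (localTime (history X M c θ x ε t ω) : ℝ) ≤ n := by exact_mod_cast h2
  gcongr

/-- The exploitation test failed for the current data, and for all earlier data in the round that
extended them; hence every `m_l` entering `η_s` is bounded, not only the last. -/
lemma minAlt_le_of_suffix (hrun : IsRun P ℱ X M c θ x ε) (hL : ∀ a ∈ X, ‖a‖ ≤ L) {t n : ℕ}
    (ht : t < n) {ω : Ω} (hω : ω ∈ exploreSet X M c θ x ε t) {h : Data d}
    (hs : h <:+ history X M c θ x ε t ω) :
    minAlt X M c h ≤ ENNReal.ofReal (confBound d L n / 2) := by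
  obtain ⟨i, hi, rfl, hiω⟩ : ∃ i ≤ t, h = history X M c θ x ε i ω ∧
      ω ∈ exploreSet X M c θ x ε i := by
    rcases eq_or_exists_of_suffix_collect hs with he | ⟨i, hi, he, hiω⟩
    · exact ⟨t, le_rfl, he, hω⟩
    · exact ⟨i, hi.le, he, hiω⟩
  have h1 := mem_exploreSet.mp hiω
  rw [Exploit, not_le] at h1
  refine h1.le.trans (ENNReal.ofReal_le_ofReal ?_)
  have hn : ((i + 1 : ℕ) : ℝ) ≤ n := by exact_mod_cast (Nat.succ_le_succ hi).trans ht
  have hn1 : (1 : ℝ) ≤ n := by exact_mod_cast (Nat.succ_le_succ (Nat.zero_le t)).trans ht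
  have := sq_sqrtBeta_history_le hrun hL (hi.trans ht.le)
    (le_max_left 1 (((i + 1 : ℕ) : ℝ) * Real.log ((i + 1 : ℕ) : ℝ))) (n := n)
    (max_le (one_le_pow₀ hn1) ?_) ω
  · linarith
  · have h2 := Real.log_le_self (Nat.cast_nonneg (α := ℝ) (i + 1))
    rw [sq]
    have h3 : (0 : ℝ) ≤ ((i + 1 : ℕ) : ℝ) := Nat.cast_nonneg _
    exact mul_le_mul hn (h2.trans hn) (Real.log_nonneg (by push_cast; linarith [Nat.cast_nonneg (α := ℝ) i]))
      (Nat.cast_nonneg _)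

variable (X M c θ x ε) in
/-- The event that the confidence set misses the true parameter in an exploration round. -/
def missSet (t : ℕ) : Set Ω := exploreSet X M c θ x ε t ∩
  {ω | radius (history X M c θ x ε t ω) <
    √(quadSq (gram (history X M c θ x ε t ω)) (lsq (history X M c θ x ε t ω) - θ))}

lemma StatMeasurable.radius {Ω : Type*} [MeasurableSpace Ω] {h : Ω → Data d}
    (hh : StatMeasurable θ h) (hl : Measurable fun ω => (h ω).length) :
    Measurable fun ω => radius (h ω) := by
  have h1 := hh.det
  have h2 : Measurable fun ω => ((h ω).length : ℝ) := measurable_from_nat.comp hl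
  unfold LinBandit.radius sqrtBeta localTime
  push_cast
  fun_prop

lemma StatMeasurable.measurableSet_radius_lt {Ω : Type*} [MeasurableSpace Ω] {h : Ω → Data d}
    (hh : StatMeasurable θ h) (hl : Measurable fun ω => (h ω).length) :
    MeasurableSet {ω | LinBandit.radius (h ω) < √(quadSq (gram (h ω)) (lsq (h ω) - θ))} :=
  measurableSet_lt (hh.radius hl) hh.error.sqrt

lemma measurableSet_missSet (hrun : IsRun P ℱ X M c θ x ε) (t : ℕ) :
    MeasurableSet[ℱ t] (missSet X M c θ x ε t) := by
  have hst := statMeasurable_history hrun t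
  have hl := measurable_length_collect (θ := θ) (x := x) (ε := ε)
    (measurableSet_exploreSet hrun) t
  exact (measurableSet_exploreSet hrun t).inter
    (@StatMeasurable.measurableSet_radius_lt d θ Ω (ℱ t) _ hst hl)

end HistoryBounds

/-! ### Expected regret of the three kinds of rounds -/

section Bounds

variable {d : ℕ} {Ω : Type*} {mΩ : MeasurableSpace Ω} {P : Measure Ω} [IsProbabilityMeasure P]
  {ℱ : Filtration ℕ mΩ} {X : Finset (Vec d)} {M : Set (Vec d)} {c : Choices d}
  {θ xstar : Vec d} {x : ℕ → Ω → Vec d} {ε : ℕ → Ω → ℝ}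

/-- Regret of the exploitation part of a round. -/
lemma integral_exploit_regret_le (hrun : IsRun P ℱ X M c θ x ε) (hc : IsIDS X M c)
    (hθ : ‖θ‖ ≤ 1) (hθM : θ ∈ M) (hs : xstar ∈ X) (h0 : ∀ a ∈ X, 0 ≤ ⟪xstar - a, θ⟫)
    (h1 : ∀ a ∈ X, ⟪xstar - a, θ⟫ ≤ 1) (t : ℕ) :
    Integrable (fun ω => (exploreSet X M c θ x ε t)ᶜ.indicator
      (fun _ => ⟪xstar - x (t + 1) ω, θ⟫) ω) P ∧
    ∫ ω, (exploreSet X M c θ x ε t)ᶜ.indicator (fun _ => ⟪xstar - x (t + 1) ω, θ⟫) ω ∂P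
      ≤ 2 * (t + 1 : ℝ)⁻¹ := by
  classical
  have hE := measurableSet_exploreSet hrun t
  obtain ⟨hint, hpint, heq⟩ := integral_action_eq hrun t
    (f := fun a => (exploreSet X M c θ x ε t)ᶜ.indicator fun _ => ⟪xstar - a, θ⟫) (K := 1)
    (fun a _ => measurable_const.indicator hE.compl) (fun a ha ω => by
      by_cases hω : ω ∈ (exploreSet X M c θ x ε t)ᶜ
      · rw [Set.indicator_of_mem hω, abs_of_nonneg (h0 a ha)]; exact h1 a ha
      · rw [Set.indicator_of_notMem hω]; simp)
  refine ⟨hint, heq.le.trans ?_⟩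
  obtain ⟨hei, hele⟩ := integral_evidence_le hrun (measurableSet_exploreSet hrun) t
  have hpos : (0 : ℝ) < (t + 1 : ℝ)⁻¹ := by positivity
  -- Markov's inequality in pointwise form: a regret of at most `1` is paid only where the evidence
  -- is at least `(t + 1) / 2`.
  refine (integral_mono (g := fun ω => 2 * (t + 1 : ℝ)⁻¹ * evidence θ (history X M c θ x ε t ω))
    hpint (hei.const_mul _) fun ω => ?_).trans ?_
  · have hev := evidence_nonneg θ (history X M c θ x ε t ω)
    by_cases hω : ω ∈ exploreSet X M c θ x ε t
    · simp only [Set.indicator, Set.mem_compl_iff, hω, not_true, if_false, zero_mul,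
        Finset.sum_const_zero]
      positivity
    · have hex := not_not.mp (mt mem_exploreSet.mpr hω)
      have hxh := hc.xhat_mem (history X M c θ x ε t ω)
      have hsum : ∑ a ∈ X, (exploreSet X M c θ x ε t)ᶜ.indicator (fun _ => ⟪xstar - a, θ⟫) ω
          * actionProb X M c (history X M c θ x ε t ω) (t + 1) a
          = ⟪xstar - c.xhat (history X M c θ x ε t ω), θ⟫ := by
        simp only [Set.indicator, Set.mem_compl_iff, hω, not_false_iff, if_true, actionProb, hex,
          mul_ite, mul_one, mul_zero, Finset.sum_ite_eq', hxh]
      dsimp only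
      rw [hsum]
      by_cases hxs : c.xhat (history X M c θ x ε t ω) = xstar
      · rw [hxs, sub_self, inner_zero_left]; positivity
      · have h2 := le_evidence_of_exploit hθ hθM hc hs
          (fun a ha => by have := h0 a ha; rw [inner_sub_left] at this; linarith) hex hxs
        -- Global rounds `t + 1 ≥ 2` use `log 2 > 1/2`; in round one the value `1` of the maximum is
        -- enough.
        have h3 : (t + 1 : ℝ) / 2 ≤ max 1 (((t + 1 : ℕ) : ℝ) * Real.log ((t + 1 : ℕ) : ℝ)) := by
          rcases Nat.eq_zero_or_pos t with rfl | ht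
          · exact le_max_of_le_left (by norm_num)
          · refine le_max_of_le_right ?_
            push_cast
            have h4 : (2 : ℝ) ≤ t + 1 := by
              have : (1 : ℝ) ≤ t := by exact_mod_cast ht
              linarith
            have h5 := Real.log_le_log (by norm_num) h4
            have h6 := Real.log_two_gt_d9
            nlinarith
        refine (h1 _ hxh).trans ?_
        have h4 := h3.trans h2
        calc (1 : ℝ) = 2 * (t + 1 : ℝ)⁻¹ * ((t + 1 : ℝ) / 2) := by field_simp
          _ ≤ _ := by gcongr
  · rw [integral_const_mul]
    exact mul_le_of_le_one_right (by positivity) hele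

/-- Expected number of exploration rounds in which the confidence set misses the parameter. -/
lemma sum_integral_missSet_le (hrun : IsRun P ℱ X M c θ x ε) (hθ : ‖θ‖ ≤ 1) (n : ℕ) :
    ∑ t ∈ Finset.range n, ∫ ω, (missSet X M c θ x ε t).indicator (fun _ => (1 : ℝ)) ω ∂P
      ≤ ∑ k ∈ Finset.range n, (k + 1 : ℝ)⁻¹ := by
  classical
  set E := exploreSet X M c θ x ε with hE
  have hmiss : ∀ t, Integrable
      (fun ω => (missSet X M c θ x ε t).indicator (fun _ => (1 : ℝ)) ω) P := fun t =>
    (integrable_const (1 : ℝ)).indicator (ℱ.le t _ (measurableSet_missSet hrun t))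
  rw [← integral_finsetSum _ fun t _ => hmiss t]
  let w : ℕ → Data d → ℝ := fun k h =>
    if h.length = k ∧ radius h < √(quadSq (gram h) (lsq h - θ)) then 1 else 0
  let Z : ℕ → Ω → Data d := fun k => collect (frozenSet E θ x ε k) θ x ε n
  -- A miss with `k` observations forces evidence at least `(k + 1)²`. The weaker `k + 1` suffices,
  -- and gives the same harmonic sum as exploitation.
  have hw : ∀ k h, w k h ≤ (k + 1 : ℝ)⁻¹ * evidence θ h := by
    intro k h
    have hev := evidence_nonneg θ h
    simp only [w]
    split_ifs with hb
    · obtain ⟨rfl, hb⟩ := hb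
      have h1 : (1 : ℝ) ≤ (localTime h : ℝ) := by simp [localTime]
      have h2 := le_evidence hθ h (one_le_pow₀ h1 (n := 2)) hb.le
      have h3 : (localTime h : ℝ) = h.length + 1 := by simp [localTime]
      rw [h3] at h2 h1
      rw [inv_mul_eq_div, le_div_iff₀ (by positivity)]
      nlinarith
    · positivity
  have hpath : ∀ ω, ∑ t ∈ Finset.range n, (missSet X M c θ x ε t).indicator (fun _ => (1 : ℝ)) ω
      ≤ ∑ k ∈ Finset.range n, (k + 1 : ℝ)⁻¹ * evidence θ (Z k ω) := by
    intro ω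
    -- Misses are sorted by `k` since the confidence level refers to local time; each `k` occurs in
    -- at most one exploration round.
    have h1 : ∀ t ∈ Finset.range n, (missSet X M c θ x ε t).indicator (fun _ => (1 : ℝ)) ω
        = ∑ k ∈ Finset.range n, (E t ∩ {ω | (collect E θ x ε t ω).length = k}).indicator
          (fun ω => w k (collect E θ x ε t ω)) ω := by
      intro t ht
      have hl : (collect E θ x ε t ω).length < n :=
        (length_collect_le t ω).trans_lt (Finset.mem_range.mp ht)
      rw [Finset.sum_eq_single_of_mem _ (Finset.mem_range.mpr hl)]
      · by_cases hω : ω ∈ E t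
        · simp [missSet, Set.indicator, hω, w, ← hE, history]
        · simp [missSet, Set.indicator, hω, ← hE]
      · intro k _ hk
        rw [Set.indicator_of_notMem]
        exact fun h => hk h.2.symm
    rw [Finset.sum_congr rfl h1, Finset.sum_comm]
    exact Finset.sum_le_sum fun k _ => sum_indicator_length_eq_le
      (fun h => (k + 1 : ℝ)⁻¹ * evidence θ h)
      (fun h => mul_nonneg (by positivity) (evidence_nonneg _ _)) (hw k) k n ω
  have hZ := fun k => integral_evidence_le hrun
    (measurableSet_frozenSet (θ := θ) (x := x) (ε := ε) (measurableSet_exploreSet hrun) k) n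
  have hZi : ∀ k ∈ Finset.range n, Integrable
      (fun ω => (k + 1 : ℝ)⁻¹ * evidence θ (Z k ω)) P := fun k _ => (hZ k).1.const_mul _
  refine (integral_mono (integrable_finsetSum _ fun t _ => hmiss t)
    (integrable_finsetSum _ hZi) hpath).trans ?_
  rw [integral_finsetSum _ hZi]
  refine Finset.sum_le_sum fun k _ => ?_
  rw [integral_const_mul]
  exact mul_le_of_le_one_right (by positivity) (hZ k).2

variable {L : ℝ}

/-- Regret of an exploration round on the confidence event, in terms of the information. -/
lemma integral_explore_regret_le (hrun : IsRun P ℱ X M c θ x ε) (hc : IsIDS X M c)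
    (hX : 2 ≤ X.card) (hL : ∀ a ∈ X, ‖a‖ ≤ L) (hs : xstar ∈ X)
    (h0 : ∀ a ∈ X, 0 ≤ ⟪xstar - a, θ⟫) (h1 : ∀ a ∈ X, ⟪xstar - a, θ⟫ ≤ 1) {Δ : ℝ} (hΔ : 0 ≤ Δ)
    (hgap : ∀ a ∈ X, a ≠ xstar → Δ ≤ ⟪xstar - a, θ⟫) {t n : ℕ} (ht : t < n) :
    Integrable (fun ω => (exploreSet X M c θ x ε t \ missSet X M c θ x ε t).indicator
      (fun _ => ⟪xstar - x (t + 1) ω, θ⟫) ω) P ∧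
    Integrable (fun ω => (exploreSet X M c θ x ε t).indicator
      (fun ω => quadSq (gram (history X M c θ x ε t ω))⁻¹ (x (t + 1) ω)) ω) P ∧
    Δ * ∫ ω, (exploreSet X M c θ x ε t \ missSet X M c θ x ε t).indicator
        (fun _ => ⟪xstar - x (t + 1) ω, θ⟫) ω ∂P
      ≤ 128 * d * (4 * confBound d L n) * ∫ ω, (exploreSet X M c θ x ε t).indicator
        (fun ω => quadSq (gram (history X M c θ x ε t ω))⁻¹ (x (t + 1) ω)) ω ∂P := by
  classical
  have hE := measurableSet_exploreSet hrun t
  have hst := statMeasurable_history hrun t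
  set E := exploreSet X M c θ x ε t with hEdef
  set S := E \ missSet X M c θ x ε t with hS
  set H := history X M c θ x ε t with hH
  obtain ⟨hint, hpint, heq⟩ := integral_action_eq hrun t
    (f := fun a => S.indicator fun _ => ⟪xstar - a, θ⟫) (K := 1)
    (fun a _ => measurable_const.indicator (hE.diff (measurableSet_missSet hrun t)))
    (fun a ha ω => by
      by_cases hω : ω ∈ S
      · rw [Set.indicator_of_mem hω, abs_of_nonneg (h0 a ha)]; exact h1 a ha
      · rw [Set.indicator_of_notMem hω]; simp)
  obtain ⟨hint', hpint', heq'⟩ := integral_action_eq hrun t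
    (f := fun a => E.indicator fun ω => quadSq (gram (H ω))⁻¹ a) (K := L ^ 2)
    (fun a _ => (@StatMeasurable.quadSq_inv d Ω (ℱ t) θ H hst _ measurable_const).indicator hE)
    (fun a ha ω => by
      by_cases hω : ω ∈ E
      · rw [Set.indicator_of_mem hω, abs_of_nonneg (gram_inv_nonneg _ _)]
        exact (quadSq_gram_inv_le _ _).trans (pow_le_pow_left₀ (norm_nonneg _) (hL a ha) 2)
      · rw [Set.indicator_of_notMem hω, abs_zero]; positivity)
  have hB := one_le_confBound d L n
  refine ⟨hint, hint', ?_⟩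
  change Δ * ∫ ω, (fun a => S.indicator fun _ => ⟪xstar - a, θ⟫) (x (t + 1) ω) ω ∂P ≤ _ *
    ∫ ω, (fun a => E.indicator fun ω => quadSq (gram (H ω))⁻¹ a) (x (t + 1) ω) ω ∂P
  rw [heq, heq', ← integral_const_mul, ← integral_const_mul]
  refine integral_mono (hpint.const_mul _) (hpint'.const_mul _) fun ω => ?_
  dsimp only
  have hnn : ω ∈ E → 0 ≤ ∑ a ∈ X, c.mu (H ω) a * quadSq (gram (H ω))⁻¹ a := fun _ =>
    Finset.sum_nonneg fun a ha => mul_nonneg ((hc.mu_distr _).1 a ha) (gram_inv_nonneg _ _)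
  by_cases hω : ω ∈ E
  · have hprob : ∀ a, actionProb X M c (history X M c θ x ε t ω) (t + 1) a = c.mu (H ω) a :=
      fun a => by rw [actionProb, if_neg (mem_exploreSet.mp hω)]
    have hr : ∑ a ∈ X, E.indicator (fun ω => quadSq (gram (H ω))⁻¹ a) ω
        * actionProb X M c (history X M c θ x ε t ω) (t + 1) a
        = ∑ a ∈ X, c.mu (H ω) a * quadSq (gram (H ω))⁻¹ a :=
      Finset.sum_congr rfl fun a _ => by rw [hprob, Set.indicator_of_mem hω, mul_comm]
    rw [hr]
    by_cases hωS : ω ∈ S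
    · have hl : ∑ a ∈ X, S.indicator (fun _ => ⟪xstar - a, θ⟫) ω
          * actionProb X M c (history X M c θ x ε t ω) (t + 1) a
          = ∑ a ∈ X, c.mu (H ω) a * ⟪xstar - a, θ⟫ :=
        Finset.sum_congr rfl fun a _ => by rw [hprob, Set.indicator_of_mem hωS, mul_comm]
      have hgood : √(quadSq (gram (H ω)) (lsq (H ω) - θ)) ≤ radius (H ω) :=
        not_lt.mp fun h => hωS.2 ⟨hω, h⟩
      rw [hl]
      refine (minGap_mul_regret_le hc hX hB
        (fun h' hh' => minAlt_le_of_suffix hrun hL ht hω hh') hgood hs hΔ hgap).trans ?_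
      -- With `B = confBound d L n`, the coefficient `3B + radius²` is at most `4B`.
      have := sq_radius_history_le hrun hL ht ω
      have h3 := hnn hω
      gcongr
      linarith
    · simp only [Set.indicator_of_notMem hωS, zero_mul, Finset.sum_const_zero, mul_zero]
      have h3 := hnn hω
      positivity
  · have hωS : ω ∉ S := fun h => hω h.1
    simp [Set.indicator_of_notMem hωS, Set.indicator_of_notMem hω]

/-- Expected information of the exploration rounds. -/
lemma sum_integral_quadSq_le (hrun : IsRun P ℱ X M c θ x ε) (hL : ∀ a ∈ X, ‖a‖ ≤ L) {n : ℕ}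
    (hint : ∀ t < n, Integrable (fun ω => (exploreSet X M c θ x ε t).indicator
      (fun ω => quadSq (gram (history X M c θ x ε t ω))⁻¹ (x (t + 1) ω)) ω) P) :
    ∑ t ∈ Finset.range n, ∫ ω, (exploreSet X M c θ x ε t).indicator
        (fun ω => quadSq (gram (history X M c θ x ε t ω))⁻¹ (x (t + 1) ω)) ω ∂P
      ≤ (1 + L ^ 2) * (d * Real.log (1 + n * L ^ 2)) := by
  have hint' : ∀ t ∈ Finset.range n, _ := fun t ht => hint t (Finset.mem_range.mp ht)
  rw [← integral_finsetSum _ hint']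
  have hpath : ∀ ω, ∑ t ∈ Finset.range n, (exploreSet X M c θ x ε t).indicator
        (fun ω => quadSq (gram (history X M c θ x ε t ω))⁻¹ (x (t + 1) ω)) ω
      ≤ (1 + L ^ 2) * (d * Real.log (1 + n * L ^ 2)) := fun ω => by
    refine (sum_indicator_quadSq_le (fun t ω => hL _ (hrun.action_mem t ω)) n ω).trans ?_
    have := log_det_gram_le (L := L) (collect (exploreSet X M c θ x ε) θ x ε n ω)
      (forall_mem_collect (p := fun v => ‖v‖ ≤ L) (fun t ω => hL _ (hrun.action_mem t ω)) n ω)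
      (length_collect_le n ω)
    gcongr
  refine (integral_mono (integrable_finsetSum _ hint') (integrable_const _) hpath).trans ?_
  simp

/-- Nonasymptotic gap-dependent regret bound. -/
lemma sum_integral_regret_le (hrun : IsRun P ℱ X M c θ x ε) (hc : IsIDS X M c)
    (hX : 2 ≤ X.card) (hL : ∀ a ∈ X, ‖a‖ ≤ L) (hθ : ‖θ‖ ≤ 1) (hθM : θ ∈ M) (hs : xstar ∈ X)
    (h0 : ∀ a ∈ X, 0 ≤ ⟪xstar - a, θ⟫) (h1 : ∀ a ∈ X, ⟪xstar - a, θ⟫ ≤ 1) {Δ : ℝ} (hΔ : 0 < Δ)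
    (hgap : ∀ a ∈ X, a ≠ xstar → Δ ≤ ⟪xstar - a, θ⟫) (n : ℕ) :
    ∫ ω, ∑ t ∈ Finset.range n, ⟪xstar - x (t + 1) ω, θ⟫ ∂P
      ≤ 3 * ∑ k ∈ Finset.range n, (k + 1 : ℝ)⁻¹ + Δ⁻¹ * (128 * d * (4 * confBound d L n) *
        ((1 + L ^ 2) * (d * Real.log (1 + n * L ^ 2)))) := by
  classical
  have hexploit := integral_exploit_regret_le hrun hc hθ hθM hs h0 h1
  have hexplore := fun t (ht : t ∈ Finset.range n) => integral_explore_regret_le hrun hc hX hL hs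
    h0 h1 hΔ.le hgap (Finset.mem_range.mp ht)
  have hmiss : ∀ t, Integrable
      (fun ω => (missSet X M c θ x ε t).indicator (fun _ => (1 : ℝ)) ω) P := fun t =>
    (integrable_const (1 : ℝ)).indicator (ℱ.le t _ (measurableSet_missSet hrun t))
  have hreg : ∀ t, Integrable (fun ω => ⟪xstar - x (t + 1) ω, θ⟫) P := fun t =>
    (integral_action_eq hrun t (f := fun a _ => ⟪xstar - a, θ⟫) (K := 1)
      (fun _ _ => measurable_const) fun a ha _ => by
        rw [abs_of_nonneg (h0 a ha)]; exact h1 a ha).1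
  set E := exploreSet X M c θ x ε with hE
  set U := missSet X M c θ x ε with hU
  have hsplit : ∀ t ∈ Finset.range n, ∫ ω, ⟪xstar - x (t + 1) ω, θ⟫ ∂P
      ≤ ∫ ω, (E t)ᶜ.indicator (fun _ => ⟪xstar - x (t + 1) ω, θ⟫) ω ∂P
        + ∫ ω, (U t).indicator (fun _ => (1 : ℝ)) ω ∂P
        + ∫ ω, (E t \ U t).indicator (fun _ => ⟪xstar - x (t + 1) ω, θ⟫) ω ∂P := by
    intro t ht
    have hadd : Integrable (fun ω => (E t)ᶜ.indicator (fun _ => ⟪xstar - x (t + 1) ω, θ⟫) ω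
        + (U t).indicator (fun _ => (1 : ℝ)) ω) P := (hexploit t).1.add (hmiss t)
    rw [← integral_add (hexploit t).1 (hmiss t), ← integral_add hadd (hexplore t ht).1]
    refine integral_mono (hreg t) (hadd.add (hexplore t ht).1) fun ω => ?_
    have ha := h1 _ (hrun.action_mem t ω)
    have hsub : U t ⊆ E t := Set.inter_subset_left
    by_cases hω : ω ∈ E t
    · by_cases hω' : ω ∈ U t
      · simp [Set.indicator, hω, hω', ha]
      · simp [Set.indicator, hω, hω']
    · have hω' : ω ∉ U t := fun h => hω (hsub h)
      simp [Set.indicator, hω, hω']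
  rw [integral_finsetSum _ fun t _ => hreg t]
  refine (Finset.sum_le_sum hsplit).trans ?_
  rw [Finset.sum_add_distrib, Finset.sum_add_distrib]
  have hA : ∑ t ∈ Finset.range n, ∫ ω, (E t)ᶜ.indicator
      (fun _ => ⟪xstar - x (t + 1) ω, θ⟫) ω ∂P ≤ 2 * ∑ k ∈ Finset.range n, (k + 1 : ℝ)⁻¹ := by
    rw [Finset.mul_sum]
    exact Finset.sum_le_sum fun t _ => (hexploit t).2
  have hB := sum_integral_missSet_le hrun hθ n
  have hC : ∑ t ∈ Finset.range n, ∫ ω, (E t \ U t).indicator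
      (fun _ => ⟪xstar - x (t + 1) ω, θ⟫) ω ∂P ≤ Δ⁻¹ * (128 * d * (4 * confBound d L n) *
        ((1 + L ^ 2) * (d * Real.log (1 + n * L ^ 2)))) := by
    rw [inv_mul_eq_div, le_div_iff₀ hΔ, mul_comm, Finset.mul_sum]
    refine (Finset.sum_le_sum fun t ht => (hexplore t ht).2.2).trans ?_
    rw [← Finset.mul_sum]
    have h2 := sum_integral_quadSq_le hrun hL (n := n)
      fun t ht => (hexplore t (Finset.mem_range.mpr ht)).2.1
    have h3 := one_le_confBound d L n
    exact mul_le_mul_of_nonneg_left h2 (by positivity)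
  linarith

end Bounds

/-! ### Elementary estimates and the final constant -/

lemma sum_range_inv_le {n : ℕ} : ∑ k ∈ Finset.range n, (k + 1 : ℝ)⁻¹ ≤ 1 + Real.log n := by
  have h := harmonic_le_one_add_log n
  rw [harmonic] at h
  push_cast at h
  exact h

lemma sum_Icc_one_eq_sum_range {n : ℕ} (f : ℕ → ℝ) :
    ∑ t ∈ Finset.Icc 1 n, f t = ∑ t ∈ Finset.range n, f (t + 1) := by
  induction n with
  | zero => simp
  | succ n ih => rw [Finset.sum_Icc_succ_top (by omega), ih, Finset.sum_range_succ]

/-- For `n ≥ 2` one has `log n ≥ 1/2`, so `log (1 + L²) ≤ L² ≤ 2 L² log n`. -/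
lemma log_one_add_mul_le {n : ℕ} (hn : 2 ≤ n) (L : ℝ) :
    Real.log (1 + n * L ^ 2) ≤ (1 + 2 * L ^ 2) * Real.log n := by
  have hn' : (2 : ℝ) ≤ n := by exact_mod_cast hn
  have h1 : (1 : ℝ) + n * L ^ 2 ≤ n * (1 + L ^ 2) := by nlinarith
  have h2 := Real.log_le_log (by positivity) h1
  rw [Real.log_mul (by positivity) (by positivity)] at h2
  have h3 := Real.log_le_sub_one_of_pos (show (0 : ℝ) < 1 + L ^ 2 by positivity)
  have h4 := Real.log_le_log (by norm_num) hn'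
  have h5 := Real.log_two_gt_d9
  nlinarith [sq_nonneg L]

/-- `(a + 1)² ≤ 2a² + 2` with `a² ≤ (5 + 2L²) d log n` and `1 ≤ 2 d log n`. -/
lemma confBound_le {d n : ℕ} (hd : 1 ≤ d) (hn : 2 ≤ n) (L : ℝ) :
    confBound d L n ≤ 2 * (7 + 2 * L ^ 2) * d * Real.log n := by
  have hn' : (2 : ℝ) ≤ n := by exact_mod_cast hn
  have hd' : (1 : ℝ) ≤ d := by exact_mod_cast hd
  have h4 := Real.log_le_log (by norm_num) hn'
  have h5 := Real.log_two_gt_d9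
  have h6 := log_one_add_mul_le hn L
  have h7 : 0 ≤ Real.log (1 + n * L ^ 2) := Real.log_nonneg (by nlinarith [sq_nonneg L])
  have h8 : 0 ≤ 4 * Real.log n + d * Real.log (1 + n * L ^ 2) := by
    have : 0 ≤ Real.log n := by linarith
    positivity
  have h9 := add_sq_le (a := √(4 * Real.log n + d * Real.log (1 + n * L ^ 2))) (b := 1)
  rw [Real.sq_sqrt h8] at h9
  rw [confBound]
  have h10 : (d : ℝ) * Real.log (1 + n * L ^ 2) ≤ d * ((1 + 2 * L ^ 2) * Real.log n) := by gcongr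
  have h11 : Real.log n ≤ d * Real.log n := le_mul_of_one_le_left (by linarith) hd'
  nlinarith

end LinBandit

end

theorem theorem2 (L : ℝ) :
    ∃ C : ℝ, ∀ (d : ℕ) (X : Finset (LinBandit.Vec d)) (M : Set (LinBandit.Vec d))
      (θ xstar : LinBandit.Vec d)
      (_hspan : Submodule.span ℝ (X : Set (LinBandit.Vec d)) = ⊤)
      (_hXdiam : Metric.diam (X : Set (LinBandit.Vec d)) ≤ 1)
      (_hXnorm : ∀ a ∈ X, ‖a‖ ≤ L)
      (_hM : ∃ F : Finset (LinBandit.Vec d), M = convexHull ℝ (F : Set (LinBandit.Vec d)))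
      (_hMdiam : Metric.diam M ≤ 1)
      (_hθM : θ ∈ M) (_hθnorm : ‖θ‖ ≤ 1)
      (_hxstar : xstar ∈ X)
      (_hunique : ∀ a ∈ X, a ≠ xstar → ⟪a, θ⟫ < ⟪xstar, θ⟫)
      (hX : ∃ a ∈ X, a ≠ xstar)
      (c : LinBandit.Choices d) (_hc : LinBandit.IsIDS X M c)
      (Ω : Type*) (mΩ : MeasurableSpace Ω) (P : Measure Ω) (_hP : IsProbabilityMeasure P)
      (ℱ : Filtration ℕ mΩ) (x : ℕ → Ω → LinBandit.Vec d) (ε : ℕ → Ω → ℝ)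
      (_hrun : LinBandit.IsRun P ℱ X M c θ x ε)
      (n : ℕ) (_hn : 2 ≤ n),
      LinBandit.regret P X θ x n
        ≤ C * (LinBandit.minGap X θ xstar hX)⁻¹ * (d : ℝ) ^ 3 * Real.log n ^ 2 := by
  classical
  -- `18` comes from `3 (1 + l) ≤ 18 l²` for `l = log n > 1/2`; `1024 = 128 · 4 · 2` collects the
  -- factors of the exploration term.
  refine ⟨18 + 1024 * (7 + 2 * L ^ 2) * (1 + L ^ 2) * (1 + 2 * L ^ 2), ?_⟩
  intro d X M θ xstar _ hdiam hL _ _ hθM hθ hs huniq hX c hc Ω mΩ P hP ℱ x ε hrun n hn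
  have h0 : ∀ a ∈ X, 0 ≤ ⟪xstar - a, θ⟫ := fun a ha => by
    rw [inner_sub_left]
    by_cases h : a = xstar
    · rw [h, sub_self]
    · linarith [huniq a ha h]
  have h1 : ∀ a ∈ X, ⟪xstar - a, θ⟫ ≤ 1 := fun a ha => by
    have h2 : ‖xstar - a‖ ≤ 1 := by
      rw [← dist_eq_norm]
      exact (Metric.dist_le_diam_of_mem X.finite_toSet.isBounded hs ha).trans hdiam
    exact (real_inner_le_norm _ _).trans (mul_le_one₀ h2 (norm_nonneg _) hθ)
  set Δ := LinBandit.minGap X θ xstar hX with hΔdef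
  have hgap : ∀ a ∈ X, a ≠ xstar → Δ ≤ ⟪xstar - a, θ⟫ := fun a ha hne =>
    Finset.inf'_le (fun a => ⟪xstar - a, θ⟫) (Finset.mem_filter.mpr ⟨ha, hne⟩)
  have hΔ : 0 < Δ := by
    rw [hΔdef, LinBandit.minGap, Finset.lt_inf'_iff]
    intro a ha
    obtain ⟨ha, hne⟩ := Finset.mem_filter.mp ha
    rw [inner_sub_left]
    linarith [huniq a ha hne]
  obtain ⟨a₀, ha₀, hne₀⟩ := hX
  -- Since `Δ⁻¹ ≥ 1`, the gap-free logarithmic term can be absorbed into the main one.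
  have hΔ1 : Δ ≤ 1 := (hgap a₀ ha₀ hne₀).trans (h1 a₀ ha₀)
  have hcard : 2 ≤ X.card := Finset.one_lt_card.mpr ⟨a₀, ha₀, xstar, hs, hne₀⟩
  have hd : 1 ≤ d := by
    rcases Nat.eq_zero_or_pos d with h | h
    · subst h; exact absurd (Subsingleton.elim a₀ xstar) hne₀
    · exact h
  have hreg : LinBandit.regret P X θ x n
      = ∫ ω, ∑ t ∈ Finset.range n, ⟪xstar - x (t + 1) ω, θ⟫ ∂P := by
    rw [LinBandit.regret]
    congr 1
    funext ω
    have hne : Nonempty X := ⟨⟨xstar, hs⟩⟩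
    rw [← LinBandit.sum_Icc_one_eq_sum_range fun t => ⟪xstar - x t ω, θ⟫]
    refine le_antisymm (ciSup_le fun a => Finset.sum_le_sum fun t _ => ?_)
      (le_ciSup (f := fun a : X => ∑ t ∈ Finset.Icc 1 n, ⟪a.1 - x t ω, θ⟫)
        (Set.finite_range _).bddAbove ⟨xstar, hs⟩)
    have := h0 a a.2
    rw [inner_sub_left] at this ⊢
    rw [inner_sub_left]
    linarith
  rw [hreg]
  refine (LinBandit.sum_integral_regret_le hrun hc hcard hL hθ hθM hs h0 h1 hΔ hgap n).trans ?_
  have hn' : (2 : ℝ) ≤ n := by exact_mod_cast hn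
  have hd' : (1 : ℝ) ≤ d := by exact_mod_cast hd
  set l := Real.log n with hl
  have hl2 : 1 / 2 < l := by
    have h4 := Real.log_le_log (by norm_num) hn'
    have h5 := Real.log_two_gt_d9
    rw [hl]; linarith
  have hΔi : 1 ≤ Δ⁻¹ := (one_le_inv₀ hΔ).mpr hΔ1
  have hd3 : (1 : ℝ) ≤ (d : ℝ) ^ 3 := one_le_pow₀ hd'
  have hfirst : 3 * ∑ k ∈ Finset.range n, (k + 1 : ℝ)⁻¹ ≤ Δ⁻¹ * (18 * (d : ℝ) ^ 3 * l ^ 2) := by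
    have h2 := LinBandit.sum_range_inv_le (n := n)
    have h3 : 3 * (1 + l) ≤ 18 * l ^ 2 := by nlinarith
    have h4 : 18 * l ^ 2 ≤ 18 * (d : ℝ) ^ 3 * l ^ 2 := by nlinarith [sq_nonneg l]
    have h5 : 18 * (d : ℝ) ^ 3 * l ^ 2 ≤ Δ⁻¹ * (18 * (d : ℝ) ^ 3 * l ^ 2) :=
      le_mul_of_one_le_left (by positivity) hΔi
    linarith
  have hsecond : 128 * (d : ℝ) * (4 * LinBandit.confBound d L n) *
      ((1 + L ^ 2) * (d * Real.log (1 + n * L ^ 2)))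
      ≤ 1024 * (7 + 2 * L ^ 2) * (1 + L ^ 2) * (1 + 2 * L ^ 2) * (d : ℝ) ^ 3 * l ^ 2 := by
    have h2 := LinBandit.confBound_le hd hn L
    have h3 := LinBandit.log_one_add_mul_le hn L
    have h4 := LinBandit.one_le_confBound d L n
    have h5 : 0 ≤ Real.log (1 + n * L ^ 2) := Real.log_nonneg (by nlinarith [sq_nonneg L])
    calc 128 * (d : ℝ) * (4 * LinBandit.confBound d L n) *
          ((1 + L ^ 2) * (d * Real.log (1 + n * L ^ 2)))
        ≤ 128 * (d : ℝ) * (4 * (2 * (7 + 2 * L ^ 2) * d * l)) *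
          ((1 + L ^ 2) * (d * ((1 + 2 * L ^ 2) * l))) := by gcongr
      _ = _ := by ring
  have h6 := mul_le_mul_of_nonneg_left hsecond (inv_pos.mpr hΔ).le
  calc _ ≤ Δ⁻¹ * (18 * (d : ℝ) ^ 3 * l ^ 2) + Δ⁻¹ * (1024 * (7 + 2 * L ^ 2) * (1 + L ^ 2)
        * (1 + 2 * L ^ 2) * (d : ℝ) ^ 3 * l ^ 2) := add_le_add hfirst h6
    _ = _ := by ring
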